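/- **Theorem 4.11 (basis-free local central limit theorem).** Notation. Let $B$ be a finite set and $V\subseteq\mathbb{Q}^B$ a linear subspace of functions $f:B\to\mathbb{Q}$; let $V^{\perp}=\{g\in\mathbb{Q}^B:\sum_{b\in B} f(b)g(b)=0\ \ \forall f\in V\}$. For $q\in\{1,\infty\}$, a subspace $W\subseteq\mathbb{Q}^B$ has a *$c$-bounded integer basis in $\ell_q$* if $W$ is spanned by $\{\gamma\in W\cap\mathbb{Z}^B:\|\gamma\|_q\le c\}$. A *symmetry* of $V$ is a permutation $\pi$ of $B$ with $f\circ\pi\in V$ for all $f\in V$. Let $(\phi_a)_{a\in A}$ be a basis of $V$, regarded as the columns of a $B\times A$ matrix $\phi$ with rows $\phi(b)\in\mathbb{Q}^A$, and let $\mathcal{L}(\phi)=\{\sum_{b} n_b\,\phi(b):n_b\in\mathbb{Z}\}$ be the lattice generated by the rows, with determinant (covolume) $\det(\mathcal{L}(\phi))$. Put $$\rho(V)=\frac{\det(\mathcal{L}(\phi))}{\sqrt{\det(\phi^t\phi)}},\qquad \|\gamma\|_V=\sqrt{\gamma^t\phi(\phi^t\phi)^{-1}\phi^t\gamma}\quad(\gamma\in\mathbb{R}^B);$$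 both are independent of the choice of the basis (and $\rho(V)=1$, $\|\cdot\|_V=0$ if $V=0$). Let $\mathbf 1\in\mathbb{R}^B$ be the all-ones vector. There exists a constant $C>0$ such that the following is true. Let $B$ be a finite set and let $V$ be a linear subspace of functions $f:B\to\mathbb{Q}$. Assume that the following conditions hold for some integers $c_2,c_3\ge 1$: 1. $V$ has a $c_2$-bounded integer basis in $\ell_\infty$; 2. $V^\perp$ has a $c_3$-bounded integer basis in $\ell_1$; 3. for any $b_1,b_2\in B$ there exists a symmetry $\pi$ of $V$ satisfying $\pi(b_1)=b_2$. Let $0<p<1$ and form a random subset $T\subseteq B$ by taking each element of $B$ into $T$ independently with probability $p$. If $$\min(p|B|,(1-p)|B|)\ \ge\ C\,c_2c_3^2\,\dim(V)^6\,\log(2c_3\dim(V))^6,$$ then for every $\gamma\in\mathbb{Z}^B$ the probability of the event that $$\sum_{t\in T}f(t)=\sum_{b\in B}\gamma_b f(b)\quad\text{for all } f\in V$$ equals $$\frac{\rho(V)}{(2\pi p(1-p))^{\dim(V)/2}}\left(\exp\left(-\frac{\|\gamma-p\cdot\mathbf 1\|_V^2}{2p(1-p)}\right)+\delta(\gamma)\right)$$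 with $$|\delta(\gamma)|\le\frac{C\,\dim(V)^3\,(\log(2c_2\dim(V)))^{3/2}}{\sqrt{\min(p|B|,(1-p)|B|)}}.$$ (If $\dim V=0$, the right-hand sides of the condition and of the bound on $\delta$ are read as $0$.) -/

import Mathlib

open scoped Matrix
open Module ProbabilityTheory

noncomputable section

namespace RandomSubset

/-- The `ℓ₁` norm of an integer vector. -/
def l1Norm {B : Type*} [Fintype B] (γ : B → ℤ) : ℕ := ∑ b, (γ b).natAbs

/-- The `ℓ_∞` norm of an integer vector (equal to `0` if `B` is empty). -/
def lInftyNorm {B : Type*} [Fintype B] (γ : B → ℤ) : ℕ := Finset.univ.sup fun b => (γ b).natAbs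

/-- `W` has a `c`-bounded integer basis with respect to the norm `nrm`: it is spanned (over `ℚ`) by
the integer vectors of norm at most `c` that it contains. -/
def HasBoundedIntegerBasis {B : Type*} (nrm : (B → ℤ) → ℕ) (c : ℕ)
    (W : Submodule ℚ (B → ℚ)) : Prop :=
  Submodule.span ℚ
    {g : B → ℚ | g ∈ W ∧ ∃ γ : B → ℤ, nrm γ ≤ c ∧ ∀ b, g b = (γ b : ℚ)} = W

/-- The orthogonal complement of `V` in `ℚ^B` for the standard inner product. -/
def orthogonalComplement {B : Type*} [Fintype B] (V : Submodule ℚ (B → ℚ)) :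
    Submodule ℚ (B → ℚ) where
  carrier := {g | ∀ f ∈ V, ∑ b, f b * g b = 0}
  add_mem' := by
    intro g h hg hh f hf
    simp [mul_add, Finset.sum_add_distrib, hg f hf, hh f hf]
  zero_mem' := by
    intro f _
    simp
  smul_mem' := by
    intro c g hg f hf
    have h : ∑ b, f b * (c • g) b = c * ∑ b, f b * g b := by
      rw [Finset.mul_sum]
      exact Finset.sum_congr rfl fun b _ => by simp [mul_left_comm]
    rw [h, hg f hf, mul_zero]

/-- A symmetry of `V`: a permutation `π` of `B` with `f ∘ π ∈ V` for all `f ∈ V`. -/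
def IsSymmetry {B : Type*} (V : Submodule ℚ (B → ℚ)) (π : Equiv.Perm B) : Prop :=
  ∀ f ∈ V, f ∘ π ∈ V

section Basis

variable {B A : Type*} {V : Submodule ℚ (B → ℚ)}

/-- The `B × A` matrix `φ` whose columns are the elements `φ_a` of a basis of `V`
(with its rational entries regarded as real numbers). -/
def basisMatrix (φ : Basis A ℚ V) : Matrix B A ℝ :=
  Matrix.of fun b a => (((φ a : B → ℚ) b : ℚ) : ℝ)

/-- The lattice spanned over `ℤ` by the rows `φ(b)`, `b ∈ B`, of the matrix `φ`. -/
def rowLattice (φ : Basis A ℚ V) : Submodule ℤ (A → ℝ) :=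
  Submodule.span ℤ (Set.range fun b => basisMatrix φ b)

variable [Fintype B] [Fintype A] [DecidableEq A]

/-- `det(ℒ(φ)) / √det(φᵗ φ)`, where `det(ℒ(φ))` is the determinant of the lattice `ℒ(φ)`, that is,
its covolume with respect to Lebesgue measure. -/
def rhoOfBasis (φ : Basis A ℚ V) : ℝ :=
  ZLattice.covolume (rowLattice φ) / √(((basisMatrix φ)ᵀ * basisMatrix φ).det)

/-- The matrix `φ (φᵗ φ)⁻¹ φᵗ` of the orthogonal projection to (the real span of) `V`. -/
def projMatrixOfBasis (φ : Basis A ℚ V) : Matrix B B ℝ :=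
  basisMatrix φ * ((basisMatrix φ)ᵀ * basisMatrix φ)⁻¹ * (basisMatrix φ)ᵀ

end Basis

section Space

variable {B : Type*} [Fintype B]

/-- The parameter `ρ(V) = det(ℒ(φ)) / √det(φᵗ φ)`; by `rho_eq` below any basis `φ` of `V` may be
used to compute it. -/
def rho (V : Submodule ℚ (B → ℚ)) : ℝ := rhoOfBasis (finBasis ℚ V)

/-- The form `⟨γ₁, γ₂⟩_V = γ₁ᵗ φ (φᵗ φ)⁻¹ φᵗ γ₂`; by `formV_eq` below any basis `φ` of `V` may be
used to compute it. -/
def formV (V : Submodule ℚ (B → ℚ)) (γ₁ γ₂ : B → ℝ) : ℝ :=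
  γ₁ ⬝ᵥ (projMatrixOfBasis (finBasis ℚ V) *ᵥ γ₂)

/-- The seminorm `‖γ‖_V = √⟨γ, γ⟩_V`. -/
def normV (V : Submodule ℚ (B → ℚ)) (γ : B → ℝ) : ℝ := √(formV V γ γ)

end Space

section WellDefined

variable {B A A' : Type*} [Fintype B] [Fintype A] [DecidableEq A] [Fintype A'] [DecidableEq A']
  {V : Submodule ℚ (B → ℚ)}

theorem isUnit_det_gram (φ : Basis A ℚ V) :
    IsUnit ((basisMatrix φ)ᵀ * basisMatrix φ).det := by
  set N : Matrix B A ℚ := Matrix.of fun b a => (φ a : B → ℚ) b with hN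
  have hM : basisMatrix φ = N.map (algebraMap ℚ ℝ) := by
    ext b a
    simp [basisMatrix, hN]
  have hinj : Function.Injective N.mulVecLin := by
    have h1 : LinearIndependent ℚ N.col :=
      (φ.linearIndependent.map' V.subtype (Submodule.ker_subtype V))
    exact Matrix.mulVec_injective_iff.2 h1
  have hker : LinearMap.ker (Nᵀ * N).mulVecLin = ⊥ := by
    rw [Matrix.ker_mulVecLin_transpose_mul_self]
    exact LinearMap.ker_eq_bot.2 hinj
  have hu : IsUnit (Nᵀ * N).det := by
    rw [← Matrix.isUnit_iff_isUnit_det]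
    exact Matrix.mulVec_injective_iff_isUnit.1 (LinearMap.ker_eq_bot.1 hker)
  have hg : (basisMatrix φ)ᵀ * basisMatrix φ = (Nᵀ * N).map (algebraMap ℚ ℝ) := by
    rw [hM, Matrix.map_mul, Matrix.transpose_map]
  rw [hg, ← RingHom.mapMatrix_apply, ← RingHom.map_det]
  exact hu.map _

instance discreteTopology_rowLattice (φ : Basis A ℚ V) : DiscreteTopology (rowLattice φ) := by
  obtain ⟨N, hN⟩ := IsLocalization.exist_integer_multiples_of_finite (nonZeroDivisors ℤ)
    (fun q : B × A => (φ q.2 : B → ℚ) q.1)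
  have hN0 : ((N : ℤ) : ℝ) ≠ 0 := by
    exact_mod_cast nonZeroDivisors.ne_zero N.2
  let β : Basis A ℝ (A → ℝ) :=
    (Pi.basisFun ℝ A).unitsSMul fun _ => (Units.mk0 _ hN0)⁻¹
  have hsub : (rowLattice φ : Set (A → ℝ)) ⊆ (Submodule.span ℤ (Set.range β) : Set (A → ℝ)) := by
    refine Submodule.span_le.2 ?_
    rintro _ ⟨b, rfl⟩
    rw [SetLike.mem_coe, Basis.mem_span_iff_repr_mem]
    intro a
    obtain ⟨z, hz⟩ := hN (b, a)
    refine ⟨z, ?_⟩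
    have hz' : ((z : ℚ) : ℝ) = (((N : ℤ) : ℚ) * (φ a : B → ℚ) b : ℚ) := by
      have := hz
      simp only [algebraMap_int_eq, eq_intCast, zsmul_eq_mul] at this
      exact_mod_cast this
    simp only [β, Basis.repr_unitsSMul]
    simp [basisMatrix, Units.smul_def]
    push_cast at hz'
    exact hz'
  have : DiscreteTopology (Submodule.span ℤ (Set.range β) : Set (A → ℝ)) :=
    inferInstanceAs (DiscreteTopology (Submodule.span ℤ (Set.range β)))
  exact DiscreteTopology.of_subset this hsub

instance isZLattice_rowLattice (φ : Basis A ℚ V) : IsZLattice ℝ (rowLattice φ) where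
  span_top := by
    rw [eq_top_iff]
    intro x _
    set M := basisMatrix φ with hM
    have hx : x = ∑ b, ((M *ᵥ ((Mᵀ * M)⁻¹ *ᵥ x)) b) • M b := by
      have h : Mᵀ *ᵥ (M *ᵥ ((Mᵀ * M)⁻¹ *ᵥ x)) = x := by
        rw [Matrix.mulVec_mulVec, Matrix.mulVec_mulVec,
          Matrix.mul_nonsing_inv _ (isUnit_det_gram φ), Matrix.one_mulVec]
      conv_lhs => rw [← h]
      ext a
      simp [Matrix.mulVec, dotProduct, mul_comm]
    rw [hx]
    exact Submodule.sum_mem _ fun b _ => Submodule.smul_mem _ _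
      (Submodule.subset_span (Submodule.subset_span ⟨b, rfl⟩))

/-- The (real) change of basis matrix. -/
def changeMatrix (φ : Basis A ℚ V) (φ' : Basis A' ℚ V) : Matrix A A' ℝ :=
  (φ.toMatrix φ').map (algebraMap ℚ ℝ)

theorem changeMatrix_mul (φ : Basis A ℚ V) (φ' : Basis A' ℚ V) :
    changeMatrix φ φ' * changeMatrix φ' φ = 1 := by
  rw [changeMatrix, changeMatrix, ← Matrix.map_mul, Basis.toMatrix_mul_toMatrix_flip]
  simp

theorem basisMatrix_mul (φ : Basis A ℚ V) (φ' : Basis A' ℚ V) :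
    basisMatrix φ * changeMatrix φ φ' = basisMatrix φ' := by
  ext b a'
  have h : ((∑ a, φ.toMatrix φ' a a' • φ a : V) : B → ℚ) b = (φ' a' : B → ℚ) b := by
    rw [Basis.sum_toMatrix_smul_self]
  simp only [Matrix.mul_apply, basisMatrix, changeMatrix, Matrix.of_apply, Matrix.map_apply]
  rw [← h]
  simp [-Basis.sum_toMatrix_smul_self, mul_comm]

theorem projMatrixOfBasis_eq (φ : Basis A ℚ V) (φ' : Basis A' ℚ V) :
    projMatrixOfBasis φ' = projMatrixOfBasis φ := by
  have hG := isUnit_det_gram φ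
  rw [projMatrixOfBasis, projMatrixOfBasis, ← basisMatrix_mul φ φ']
  set M := basisMatrix φ
  set Q := changeMatrix φ φ'
  set Q' := changeMatrix φ' φ
  have h1 : Q * Q' = 1 := changeMatrix_mul φ φ'
  have h2 : Q' * Q = 1 := changeMatrix_mul φ' φ
  have h1t : Q'ᵀ * Qᵀ = 1 := by rw [← Matrix.transpose_mul, h1, Matrix.transpose_one]
  have h2t : Qᵀ * Q'ᵀ = 1 := by rw [← Matrix.transpose_mul, h2, Matrix.transpose_one]
  have hinv : ((M * Q)ᵀ * (M * Q))⁻¹ = Q' * (Mᵀ * M)⁻¹ * Q'ᵀ := by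
    apply Matrix.inv_eq_right_inv
    calc (M * Q)ᵀ * (M * Q) * (Q' * (Mᵀ * M)⁻¹ * Q'ᵀ)
        = Qᵀ * ((Mᵀ * M) * (Q * Q') * (Mᵀ * M)⁻¹) * Q'ᵀ := by
          simp only [Matrix.transpose_mul, Matrix.mul_assoc]
      _ = 1 := by
          rw [h1, Matrix.mul_one, Matrix.mul_nonsing_inv _ hG, Matrix.mul_one, h2t]
  rw [hinv, Matrix.transpose_mul]
  calc M * Q * (Q' * (Mᵀ * M)⁻¹ * Q'ᵀ) * (Qᵀ * Mᵀ)
      = M * ((Q * Q') * (Mᵀ * M)⁻¹ * (Q'ᵀ * Qᵀ)) * Mᵀ := by simp only [Matrix.mul_assoc]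
    _ = M * (Mᵀ * M)⁻¹ * Mᵀ := by rw [h1, h1t, Matrix.one_mul, Matrix.mul_one]

theorem rhoOfBasis_eq (φ : Basis A ℚ V) (φ' : Basis A' ℚ V) : rhoOfBasis φ' = rhoOfBasis φ := by
  let σ : A ≃ A' := φ.indexEquiv φ'
  set M := basisMatrix φ with hM
  set Q := changeMatrix φ φ' with hQ
  have hMQ : basisMatrix φ' = M * Q := (basisMatrix_mul φ φ').symm
  set S : Matrix A A ℝ := Q.submatrix id σ with hS
  have h1 : Q * changeMatrix φ' φ = 1 := changeMatrix_mul φ φ'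
  have hinj : Function.Injective Q.vecMulLinear := by
    intro x y hxy
    have h := congrArg (fun v => v ᵥ* changeMatrix φ' φ) hxy
    simpa [Matrix.vecMulLinear_apply, Matrix.vecMul_vecMul, h1] using h
  have hS0 : S.det ≠ 0 := by
    have h2 : S * (changeMatrix φ' φ).submatrix σ id = 1 := by
      rw [hS, Matrix.submatrix_mul_equiv, h1]
      simp
    exact fun h => by simpa [h] using congrArg Matrix.det h2
  have hL : (rowLattice φ).map (Q.vecMulLinear.restrictScalars ℤ) = rowLattice φ' := by
    rw [rowLattice, rowLattice, Submodule.map_span, ← Set.range_comp, hMQ]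
    rfl
  let β : Basis A ℤ (rowLattice φ) := IsZLattice.basis (rowLattice φ)
  let e : rowLattice φ ≃ₗ[ℤ] rowLattice φ' :=
    (Submodule.equivMapOfInjective (Q.vecMulLinear.restrictScalars ℤ) hinj (rowLattice φ)).trans
      (LinearEquiv.ofEq _ _ hL)
  let β' : Basis A' ℤ (rowLattice φ') := (β.map e).reindex σ
  have hcov : ZLattice.covolume (rowLattice φ') = ZLattice.covolume (rowLattice φ) * |S.det| := by
    rw [ZLattice.covolume_eq_det _ β, ZLattice.covolume_eq_det _ β', ← abs_mul, ← Matrix.det_mul]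
    congr 1
    rw [← Matrix.det_submatrix_equiv_self σ]
    congr 1
    ext i j
    have hij : (β' (σ i) : A' → ℝ) (σ j) = ((β i : A → ℝ) ᵥ* Q) (σ j) := by
      simp only [β', Basis.reindex_apply, Equiv.symm_apply_apply, Basis.map_apply]
      rfl
    simpa [hS, Matrix.mul_apply, Matrix.vecMul, dotProduct] using hij
  have hdet : ((basisMatrix φ')ᵀ * basisMatrix φ').det = (Mᵀ * M).det * |S.det| ^ 2 := by
    rw [← Matrix.det_submatrix_equiv_self σ, hMQ]
    have : ((M * Q)ᵀ * (M * Q)).submatrix σ σ = Sᵀ * (Mᵀ * M) * S := by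
      have h3 : M * S = (M * Q).submatrix id σ := rfl
      calc ((M * Q)ᵀ * (M * Q)).submatrix σ σ = (M * S)ᵀ * (M * S) := rfl
        _ = Sᵀ * (Mᵀ * M) * S := by simp only [Matrix.transpose_mul, Matrix.mul_assoc]
    rw [this, Matrix.det_mul, Matrix.det_mul, Matrix.det_transpose, sq_abs]
    ring
  rw [rhoOfBasis, rhoOfBasis, hcov, hdet, Real.sqrt_mul' _ (by positivity),
    Real.sqrt_sq (abs_nonneg _), mul_div_mul_right _ _ (abs_ne_zero.2 hS0)]

/-- `ρ(V)` does not depend on the choice of a basis. -/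
theorem rho_eq (φ : Basis A ℚ V) :
    rho V = ZLattice.covolume (rowLattice φ) / √(((basisMatrix φ)ᵀ * basisMatrix φ).det) :=
  rhoOfBasis_eq φ (finBasis ℚ V)

/-- `⟨·, ·⟩_V` does not depend on the choice of a basis. -/
theorem formV_eq (φ : Basis A ℚ V) (γ₁ γ₂ : B → ℝ) :
    formV V γ₁ γ₂ =
      γ₁ ⬝ᵥ ((basisMatrix φ * ((basisMatrix φ)ᵀ * basisMatrix φ)⁻¹ * (basisMatrix φ)ᵀ) *ᵥ γ₂) := by
  rw [formV, projMatrixOfBasis_eq φ (finBasis ℚ V), projMatrixOfBasis]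

end WellDefined

end RandomSubset

end

/-!
# A local limit theorem for random subsets

Let `n = dim V`, `N = |B|`, `q = p (1 - p)`. The functionals `f ↦ f b` on `V` generate a lattice in
the dual space; the basis of `V` dual to a `ℤ`-basis of that lattice consists of integer-valued
functions, and the rows `Φ b` of its matrix `M` generate exactly `ℤⁿ` (`exists_integer_basis`). In
this basis `ρ(V)` is `1 / √det(Mᵗ M)`, and the probability is, by Fourier inversion, the integral
over the unit cube of `∏_b (1 - p + p e(f b))` times a character, where `f = M θ` and
`e(x) = e^{2πix}` (`setBernoulli_real_eq_integral`). The integrand is `ℤⁿ`-periodic, so the cube may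
be exchanged for the fundamental domain that consists of the neighbourhood `‖f‖_∞ < ε` of the origin
and of points all of whose translates lie outside it (`norm_setIntegral_sub_setIntegral_le`). Here
`ε` is of order `1 / (c₃ √n)`.

*Near the origin* one passes to orthonormal coordinates, in which the evaluations at the points of
`B` form a Parseval frame; a transitive group of symmetries forces all its vectors to have the same
length `√(n / N)`, so that `‖f‖_∞ ≤ √(n / N) ‖f‖₂` (`norm_frameVector_sq`). A third order Taylor
expansion of each factor then shows that the product is the Gaussian `exp (-2π²q ‖f‖₂²)` up to an
error `O(n² / √(qN))` times a Gaussian wider by the factor `(1 - 1/(2n))⁻¹` only, whose integral is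
larger by a constant (`norm_setIntegral_sub_gaussian_le`).

*Away from the lattice* some value `f b₀` has distance at least `ε` from the integers: otherwise the
short integer vectors that span `V^⊥` would show that rounding the values of `f` gives an element
of `V` (`round_mem`). By the pigeonhole principle, any tuple of `s ≈ n log (2 c₂ n)` points supports
a nonzero relation with coefficients in `{-1, 0, 1}` between the evaluations on `V`
(`exists_sign_relation`). Moving a point of its support to `b₀` by a symmetry bounds the distance of
`f b₀` from the integers by the sum of the distances at the other points, and averaging over all
tuples shows that the mean distance over `B` is at least `ε / s²` (`card_mul_abs_sub_round_le`).
Hence the product of the `N` factors is at most `exp (-8 q N ε² / s⁴)`, which the lower bound for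
`min (p N) ((1 - p) N)` makes negligible even after division by `ρ(V)`, since `det(Mᵗ M)` is at most
`(n c₂² N)ⁿ` (`det_gram_le`, `error_le`).
-/

noncomputable section

namespace RandomSubset

/-! ### The characteristic function of a Bernoulli variable -/

/-- The characteristic function `x ↦ 1 - p + p e^{2πix}` of a Bernoulli variable with
parameter `p`, in the normalization in which it has period `1`. -/
def bernoulliChar (p x : ℝ) : ℂ := (1 - p) + p * Complex.exp (2 * Real.pi * x * Complex.I)

theorem norm_bernoulliChar_sq (p x : ℝ) :
    ‖bernoulliChar p x‖ ^ 2 = 1 - 4 * (p * (1 - p)) * Real.sin (Real.pi * x) ^ 2 := by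
  have h : bernoulliChar p x = ((1 - p + p * Real.cos (2 * Real.pi * x) : ℝ) : ℂ) +
      ((p * Real.sin (2 * Real.pi * x) : ℝ) : ℂ) * Complex.I := by
    have := Complex.exp_mul_I ((2 * Real.pi * x : ℝ) : ℂ)
    rw [bernoulliChar]
    push_cast at this ⊢
    rw [this]
    ring
  rw [h, ← Complex.normSq_eq_norm_sq, Complex.normSq_add_mul_I]
  have h1 : Real.cos (2 * Real.pi * x) = 1 - 2 * Real.sin (Real.pi * x) ^ 2 := by
    rw [mul_assoc, Real.cos_two_mul, Real.cos_sq']; ring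
  have h2 : Real.sin (2 * Real.pi * x) ^ 2 = 1 - Real.cos (2 * Real.pi * x) ^ 2 := Real.sin_sq _
  rw [mul_pow, h2, h1]
  ring

theorem norm_bernoulliChar_le {p : ℝ} (x : ℝ) :
    ‖bernoulliChar p x‖ ≤ Real.exp (-(2 * (p * (1 - p)) * Real.sin (Real.pi * x) ^ 2)) := by
  have h : ‖bernoulliChar p x‖ ^ 2 ≤
      Real.exp (-(2 * (p * (1 - p)) * Real.sin (Real.pi * x) ^ 2)) ^ 2 := by
    rw [norm_bernoulliChar_sq, ← Real.exp_nat_mul]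
    have := Real.add_one_le_exp (-(4 * (p * (1 - p)) * Real.sin (Real.pi * x) ^ 2))
    refine le_trans (by linarith) (this.trans (le_of_eq ?_))
    congr 1
    push_cast
    ring
  exact le_of_sq_le_sq h (Real.exp_nonneg _)

theorem bernoulliChar_add_intCast (p x : ℝ) (n : ℤ) :
    bernoulliChar p (x + n) = bernoulliChar p x := by
  rw [bernoulliChar, bernoulliChar]
  congr 2
  rw [Complex.exp_eq_exp_iff_exists_int]
  exact ⟨n, by push_cast; ring⟩

theorem continuous_bernoulliChar (p : ℝ) : Continuous (bernoulliChar p) := by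
  unfold bernoulliChar
  fun_prop

/-- Away from the integers the characteristic function is small: by Jordan's inequality
`|sin (πx)|` is at least twice the distance of `x` to the nearest integer. -/
theorem norm_bernoulliChar_le_round {p : ℝ} (hp₀ : 0 ≤ p) (hp₁ : p ≤ 1) (x : ℝ) :
    ‖bernoulliChar p x‖ ≤ Real.exp (-(8 * (p * (1 - p)) * |x - round x| ^ 2)) := by
  have hx : bernoulliChar p x = bernoulliChar p (x - round x) := by
    conv_lhs => rw [← sub_add_cancel x (round x : ℝ), bernoulliChar_add_intCast]
  rw [hx]
  set y := x - round x with hy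
  have hy2 : |y| ≤ 1 / 2 := abs_sub_round x
  refine (norm_bernoulliChar_le y).trans (Real.exp_le_exp.2 (neg_le_neg ?_))
  have hpi := Real.pi_pos
  have hs : 2 * |y| ≤ |Real.sin (Real.pi * y)| := by
    have h1 := Real.mul_abs_le_abs_sin (x := Real.pi * y)
      (by rw [abs_mul, abs_of_pos hpi]; nlinarith)
    rw [abs_mul, abs_of_pos hpi] at h1
    refine le_trans (le_of_eq ?_) h1
    field_simp
  have hs2 : 4 * |y| ^ 2 ≤ Real.sin (Real.pi * y) ^ 2 := by
    rw [← sq_abs (Real.sin _)]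
    nlinarith [abs_nonneg y]
  have hq : 0 ≤ p * (1 - p) := mul_nonneg hp₀ (by linarith)
  nlinarith

/-- The characteristic function of a centered Bernoulli variable. -/
def centeredChar (p x : ℝ) : ℂ :=
  bernoulliChar p x * Complex.exp (-(2 * Real.pi * (p * x)) * Complex.I)

theorem norm_centeredChar (p x : ℝ) : ‖centeredChar p x‖ = ‖bernoulliChar p x‖ := by
  have h : (-(2 * Real.pi * (p * x)) * Complex.I : ℂ) =
      ((-(2 * Real.pi * (p * x)) : ℝ) : ℂ) * Complex.I := by push_cast; ring
  rw [centeredChar, norm_mul, h, Complex.norm_exp_ofReal_mul_I, mul_one]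

theorem norm_centeredChar_le {p x κ : ℝ} (hp₀ : 0 ≤ p) (hp₁ : p ≤ 1) (hx : |x| ≤ 1 / 8)
    (hκ : 5 * x ^ 2 ≤ κ) :
    ‖centeredChar p x‖ ≤ Real.exp (-(2 * Real.pi ^ 2 * (p * (1 - p)) * (1 - κ) * x ^ 2)) := by
  rw [norm_centeredChar]
  refine (norm_bernoulliChar_le x).trans (Real.exp_le_exp.2 (neg_le_neg ?_))
  have hq : 0 ≤ p * (1 - p) := mul_nonneg hp₀ (by linarith)
  have hpi := Real.pi_pos
  have hpi4 : Real.pi < 3.15 := Real.pi_lt_d2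
  have key : Real.pi ^ 2 * (1 - κ) * x ^ 2 ≤ Real.sin (Real.pi * x) ^ 2 := by
    have hsin : Real.sin (Real.pi * x) ^ 2 = Real.sin (Real.pi * |x|) ^ 2 := by
      rcases abs_choice x with h | h <;> rw [h]
      rw [mul_neg, Real.sin_neg, neg_sq]
    rw [hsin, ← sq_abs x] at *
    set y := |x|
    rcases (abs_nonneg x).eq_or_lt with h0 | h0
    · have : y = 0 := h0.symm
      simp [this]
    have hz0 : 0 < Real.pi * y := mul_pos hpi h0
    have hz1 : Real.pi * y ≤ 1 := by nlinarith
    have h1 : Real.pi * y - (Real.pi * y) ^ 3 / 4 < Real.sin (Real.pi * y) := by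
      have := Real.sin_gt_sub_cube hz0
      have h3 := pow_pos hz0 3
      linarith
    set z := Real.pi * y
    have h2 : 0 ≤ z - z ^ 3 / 4 := by nlinarith [pow_pos hz0 2]
    have h3 : (z - z ^ 3 / 4) ^ 2 ≤ Real.sin z ^ 2 := pow_le_pow_left₀ h2 h1.le 2
    refine le_trans ?_ h3
    have h4 : z ^ 2 / 2 ≤ κ := by
      refine le_trans ?_ hκ
      have : z ^ 2 = Real.pi ^ 2 * y ^ 2 := mul_pow _ _ _
      have h5 : Real.pi ^ 2 ≤ 10 := by nlinarith
      rw [this]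
      nlinarith [sq_nonneg y]
    have h6 : Real.pi ^ 2 * (1 - κ) * y ^ 2 = z ^ 2 * (1 - κ) := by
      simp only [z]; ring
    rw [h6]
    have h7 : (z - z ^ 3 / 4) ^ 2 = z ^ 2 * (1 - z ^ 2 / 2) + (z ^ 3 / 4) ^ 2 := by ring
    rw [h7]
    nlinarith [sq_nonneg z, sq_nonneg (z ^ 3 / 4)]
  nlinarith

theorem norm_exp_mul_I_sub_le {y : ℝ} (hy : |y| ≤ 1) :
    ‖Complex.exp (y * Complex.I) - (1 + y * Complex.I - (y : ℂ) ^ 2 / 2)‖ ≤ 2 / 9 * |y| ^ 3 := by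
  have hn : ‖(y * Complex.I : ℂ)‖ = |y| := by simp
  have h := Complex.exp_bound (x := y * Complex.I) (by rw [hn]; exact hy) (n := 3) (by norm_num)
  rw [hn] at h
  have hs : ∑ m ∈ Finset.range 3, ((y : ℂ) * Complex.I) ^ m / (m.factorial : ℂ) =
      1 + y * Complex.I - (y : ℂ) ^ 2 / 2 := by
    simp [Finset.sum_range_succ, mul_pow]
    ring
  rw [hs] at h
  refine h.trans (le_of_eq ?_)
  norm_num [Nat.factorial]
  ring

/-- Near the origin the centered characteristic function agrees with the Gaussian of the same
variance up to a cubic error, whose constant carries the factor `p (1 - p)`. -/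
theorem norm_centeredChar_sub_le {p x : ℝ} (hp₀ : 0 ≤ p) (hp₁ : p ≤ 1) (hx : |x| ≤ 1 / 8) :
    ‖centeredChar p x - Real.exp (-(2 * Real.pi ^ 2 * (p * (1 - p)) * x ^ 2))‖ ≤
      100 * (p * (1 - p)) * |x| ^ 3 := by
  have hq : 0 ≤ p * (1 - p) := mul_nonneg hp₀ (by linarith)
  have hq4 : p * (1 - p) ≤ 1 / 4 := by nlinarith [sq_nonneg (p - 1 / 2)]
  have hpi := Real.pi_pos
  have hpi4 : Real.pi < 3.15 := Real.pi_lt_d2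
  have hpi2 : Real.pi ^ 2 ≤ 10 := by nlinarith
  have hpi3 : Real.pi ^ 3 ≤ 32 := by nlinarith
  set Y : ℝ := 2 * Real.pi * x with hY
  have hYabs : |Y| = 2 * Real.pi * |x| := by
    rw [hY, abs_mul, abs_of_pos (by positivity)]
  have hY1 : |Y| ≤ 1 := by rw [hYabs]; nlinarith [abs_nonneg x]
  have e1 : centeredChar p x = (1 - p) * Complex.exp ((-(p * Y) : ℝ) * Complex.I) +
      p * Complex.exp (((1 - p) * Y : ℝ) * Complex.I) := by
    rw [centeredChar, bernoulliChar, add_mul, mul_assoc (p : ℂ), ← Complex.exp_add]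
    congr 2
    · congr 1; push_cast [hY]; ring
    · congr 1; push_cast [hY]; ring
  have b1 := norm_exp_mul_I_sub_le (y := -(p * Y))
    (by rw [abs_neg, abs_mul, abs_of_nonneg hp₀]; nlinarith [abs_nonneg Y])
  have b2 := norm_exp_mul_I_sub_le (y := (1 - p) * Y)
    (by rw [abs_mul, abs_of_nonneg (by linarith)]; nlinarith [abs_nonneg Y])
  set R1 := Complex.exp ((-(p * Y) : ℝ) * Complex.I) -
    (1 + (-(p * Y) : ℝ) * Complex.I - ((-(p * Y) : ℝ) : ℂ) ^ 2 / 2)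
  set R2 := Complex.exp (((1 - p) * Y : ℝ) * Complex.I) -
    (1 + ((1 - p) * Y : ℝ) * Complex.I - (((1 - p) * Y : ℝ) : ℂ) ^ 2 / 2)
  have hz : |(-(2 * Real.pi ^ 2 * (p * (1 - p)) * x ^ 2))| ≤ 1 := by
    rw [abs_neg, abs_of_nonneg (by positivity), ← sq_abs x]
    have : |x| ^ 2 ≤ 1 / 64 := by nlinarith [abs_nonneg x]
    have h2 : Real.pi ^ 2 * (p * (1 - p)) ≤ 10 * (1 / 4) := by gcongr
    nlinarith [sq_nonneg |x|, mul_nonneg (sq_nonneg Real.pi) hq]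
  have b3 := Real.abs_exp_sub_one_sub_id_le hz
  set R3 := Real.exp (-(2 * Real.pi ^ 2 * (p * (1 - p)) * x ^ 2)) - 1 -
    -(2 * Real.pi ^ 2 * (p * (1 - p)) * x ^ 2)
  have e2 : centeredChar p x - Real.exp (-(2 * Real.pi ^ 2 * (p * (1 - p)) * x ^ 2)) =
      (1 - p : ℝ) * R1 + (p : ℝ) * R2 - (R3 : ℝ) := by
    rw [e1]
    simp only [R1, R2, R3, hY]
    push_cast
    ring
  rw [e2]
  have hx3 : 0 ≤ |x| ^ 3 := by positivity
  have c1 : ‖((1 - p : ℝ) : ℂ) * R1‖ ≤ (1 - p) * (2 / 9 * (p * |Y|) ^ 3) := by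
    rw [norm_mul, Complex.norm_real, Real.norm_of_nonneg (by linarith)]
    rw [abs_neg, abs_mul, abs_of_nonneg hp₀] at b1
    exact mul_le_mul_of_nonneg_left b1 (by linarith)
  have c2 : ‖((p : ℝ) : ℂ) * R2‖ ≤ p * (2 / 9 * ((1 - p) * |Y|) ^ 3) := by
    rw [norm_mul, Complex.norm_real, Real.norm_of_nonneg hp₀]
    rw [abs_mul, abs_of_nonneg (by linarith : 0 ≤ 1 - p)] at b2
    exact mul_le_mul_of_nonneg_left b2 hp₀
  have c3 : ‖(R3 : ℂ)‖ ≤ 15 * (p * (1 - p)) * |x| ^ 3 := by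
    rw [Complex.norm_real, Real.norm_eq_abs]
    refine b3.trans ?_
    have : (-(2 * Real.pi ^ 2 * (p * (1 - p)) * x ^ 2)) ^ 2 =
        4 * (Real.pi ^ 2) ^ 2 * (p * (1 - p)) * |x| * ((p * (1 - p)) * |x| ^ 3) := by
      rw [← sq_abs x]; ring
    rw [this]
    have h1 : 4 * (Real.pi ^ 2) ^ 2 * (p * (1 - p)) * |x| ≤ 4 * 10 ^ 2 * (1 / 4) * (1 / 8) := by
      gcongr
    have h2 : 0 ≤ (p * (1 - p)) * |x| ^ 3 := by positivity
    nlinarith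
  have hsum : (1 - p) * (2 / 9 * (p * |Y|) ^ 3) + p * (2 / 9 * ((1 - p) * |Y|) ^ 3) ≤
      60 * (p * (1 - p)) * |x| ^ 3 := by
    have h1 : (1 - p) * (2 / 9 * (p * |Y|) ^ 3) + p * (2 / 9 * ((1 - p) * |Y|) ^ 3) =
        (16 / 9 * Real.pi ^ 3 * (p ^ 2 + (1 - p) ^ 2)) * ((p * (1 - p)) * |x| ^ 3) := by
      rw [hYabs]; ring
    have h2 : 0 ≤ (p * (1 - p)) * |x| ^ 3 := by positivity
    have h3 : 16 / 9 * Real.pi ^ 3 * (p ^ 2 + (1 - p) ^ 2) ≤ 16 / 9 * 32 * 1 := by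
      gcongr
      nlinarith
    rw [h1]
    nlinarith
  calc ‖((1 - p : ℝ) : ℂ) * R1 + (p : ℝ) * R2 - (R3 : ℝ)‖
      ≤ ‖((1 - p : ℝ) : ℂ) * R1‖ + ‖((p : ℝ) : ℂ) * R2‖ + ‖(R3 : ℂ)‖ :=
        (norm_sub_le _ _).trans (add_le_add_left (norm_add_le _ _) _)
    _ ≤ 100 * (p * (1 - p)) * |x| ^ 3 := by nlinarith [mul_nonneg hq hx3]

theorem norm_prod_sub_prod_le {ι : Type*} (s : Finset ι) {f g : ι → ℂ}
    (hf : ∀ i ∈ s, ‖f i‖ ≤ 1) (hg : ∀ i ∈ s, ‖g i‖ ≤ 1) :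
    ‖∏ i ∈ s, f i - ∏ i ∈ s, g i‖ ≤ ∑ i ∈ s, ‖f i - g i‖ := by
  classical
  induction s using Finset.induction_on with
  | empty => simp
  | insert a s ha ih =>
    rw [Finset.prod_insert ha, Finset.prod_insert ha, Finset.sum_insert ha]
    have ih' := ih (fun i hi => hf i (Finset.mem_insert_of_mem hi))
      (fun i hi => hg i (Finset.mem_insert_of_mem hi))
    have h1 : ‖∏ i ∈ s, g i‖ ≤ 1 := by
      rw [norm_prod]
      exact Finset.prod_le_one (fun _ _ => norm_nonneg _)
        (fun i hi => hg i (Finset.mem_insert_of_mem hi))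
    have h2 := hf a (Finset.mem_insert_self a s)
    have e : f a * ∏ i ∈ s, f i - g a * ∏ i ∈ s, g i =
        (f a - g a) * ∏ i ∈ s, g i + f a * (∏ i ∈ s, f i - ∏ i ∈ s, g i) := by ring
    rw [e]
    refine (norm_add_le _ _).trans (add_le_add ?_ ?_)
    · rw [norm_mul]
      exact mul_le_of_le_one_right (norm_nonneg _) h1
    · rw [norm_mul]
      exact (mul_le_of_le_one_left (norm_nonneg _) h2).trans ih'

/-- A comparison of products whose factors are bounded by `exp (-m i)`. -/
theorem norm_prod_sub_prod_le_exp {ι : Type*} (s : Finset ι) {f g : ι → ℂ} {m : ι → ℝ}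
    (hf : ∀ i ∈ s, ‖f i‖ ≤ Real.exp (-m i)) (hg : ∀ i ∈ s, ‖g i‖ ≤ Real.exp (-m i)) :
    ‖∏ i ∈ s, f i - ∏ i ∈ s, g i‖ ≤
      Real.exp (-∑ i ∈ s, m i) * ∑ i ∈ s, Real.exp (m i) * ‖f i - g i‖ := by
  have hE : ∀ i, (Real.exp (-m i) : ℂ) * (Real.exp (m i) : ℂ) = 1 := fun i => by
    rw [← Complex.ofReal_mul, ← Real.exp_add]; simp
  have hn : ∀ i (z : ℂ), ‖(Real.exp (m i) : ℂ) * z‖ = Real.exp (m i) * ‖z‖ := fun i z => by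
    rw [norm_mul, Complex.norm_real, Real.norm_of_nonneg (Real.exp_nonneg _)]
  have hle : ∀ i (z : ℂ), ‖z‖ ≤ Real.exp (-m i) → ‖(Real.exp (m i) : ℂ) * z‖ ≤ 1 := fun i z hz => by
    rw [hn]
    calc Real.exp (m i) * ‖z‖ ≤ Real.exp (m i) * Real.exp (-m i) := by gcongr
      _ = 1 := by rw [← Real.exp_add]; simp
  have h := norm_prod_sub_prod_le s (f := fun i => (Real.exp (m i) : ℂ) * f i)
    (g := fun i => (Real.exp (m i) : ℂ) * g i)
    (fun i hi => hle i _ (hf i hi)) (fun i hi => hle i _ (hg i hi))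
  have e : ∀ h : ι → ℂ, ∏ i ∈ s, h i =
      (Real.exp (-∑ i ∈ s, m i) : ℂ) * ∏ i ∈ s, (Real.exp (m i) : ℂ) * h i := fun h => by
    rw [← Finset.sum_neg_distrib, Real.exp_sum, Complex.ofReal_prod, ← Finset.prod_mul_distrib]
    refine Finset.prod_congr rfl fun i _ => ?_
    rw [← mul_assoc, hE, one_mul]
  rw [e f, e g, ← mul_sub, norm_mul, Complex.norm_real, Real.norm_of_nonneg (Real.exp_nonneg _)]
  gcongr
  refine h.trans (le_of_eq (Finset.sum_congr rfl fun i _ => ?_))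
  rw [← mul_sub, hn]

/-! ### Gaussian approximation near the origin -/

section Frame

open scoped RealInnerProductSpace
open MeasureTheory

variable {B E : Type*} [Fintype B] [NormedAddCommGroup E] [InnerProductSpace ℝ E]

/-- For a Parseval frame `u`, the product of the centered characteristic functions at
`⟪u b, y⟫` is close to a Gaussian. The error is stated with the slightly wider Gaussian
`exp (-2π²p(1-p)(1 - 1/(2d)) ‖y‖²)`, which absorbs the cubic factor `‖y‖³` and whose integral in
dimension `d` is only a constant times larger. -/
theorem norm_prod_centeredChar_sub_le {u : B → E} {p d N ε : ℝ} (hp₀ : 0 < p) (hp₁ : p < 1)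
    (hd : 1 ≤ d) (hN : 0 < N) (hu : ∀ y, ∑ b, ⟪u b, y⟫ ^ 2 = ‖y‖ ^ 2)
    (hK : ∀ b, ‖u b‖ ^ 2 ≤ d / N) (hε₀ : ε ≤ 1 / 8) (hε : 64 * d * ε ^ 2 ≤ 1) {y : E}
    (hy : ∀ b, |⟪u b, y⟫| < ε) :
    ‖∏ b, centeredChar p ⟪u b, y⟫ -
        Real.exp (-(2 * Real.pi ^ 2 * (p * (1 - p)) * ‖y‖ ^ 2))‖ ≤
      600 * d ^ 2 / √(p * (1 - p) * N) *
        Real.exp (-(2 * Real.pi ^ 2 * (p * (1 - p)) * (1 - 1 / (2 * d)) * ‖y‖ ^ 2)) := by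
  set q := p * (1 - p) with hqdef
  have hq : 0 < q := mul_pos hp₀ (by linarith)
  have hq4 : q ≤ 1 / 4 := by nlinarith [sq_nonneg (p - 1 / 2)]
  have hpi := Real.pi_pos
  have hpi4 : Real.pi < 3.15 := Real.pi_lt_d2
  have hpi3 : 3.14 < Real.pi := Real.pi_gt_d2
  have hpi2 : Real.pi ^ 2 ≤ 10 := by nlinarith
  have hpi9 : 9 ≤ Real.pi ^ 2 := by nlinarith
  have hd0 : 0 < d := by linarith
  set κ : ℝ := 1 / (4 * d) with hκ
  have hκ0 : 0 < κ := by positivity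
  set x : B → ℝ := fun b => ⟪u b, y⟫ with hx
  have hx8 : ∀ b, |x b| ≤ 1 / 8 := fun b => (hy b).le.trans hε₀
  have hxsq : ∀ b, x b ^ 2 ≤ ε ^ 2 := fun b => by
    rw [← sq_abs]
    exact pow_le_pow_left₀ (abs_nonneg _) (hy b).le 2
  have hxκ : ∀ b, 5 * x b ^ 2 ≤ κ := fun b => by
    rw [hκ, le_div_iff₀ (by positivity)]
    have := hxsq b
    nlinarith
  set m : B → ℝ := fun b => 2 * Real.pi ^ 2 * q * (1 - κ) * x b ^ 2 with hm
  set g : B → ℂ := fun b => (Real.exp (-(2 * Real.pi ^ 2 * q * x b ^ 2)) : ℂ) with hg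
  have hmle : ∀ b, m b ≤ 2 * Real.pi ^ 2 * q * x b ^ 2 := fun b => by
    have : 0 ≤ Real.pi ^ 2 * q * x b ^ 2 * κ := by positivity
    simp only [hm]; nlinarith
  have hprod : ∏ b, g b = (Real.exp (-(2 * Real.pi ^ 2 * q * ‖y‖ ^ 2)) : ℂ) := by
    simp only [hg]
    rw [← Complex.ofReal_prod, ← Real.exp_sum, Finset.sum_neg_distrib, ← Finset.mul_sum, ← hu y]
  have h := norm_prod_sub_prod_le_exp Finset.univ (f := fun b => centeredChar p (x b)) (g := g)
    (m := m) (fun b _ => norm_centeredChar_le hp₀.le hp₁.le (hx8 b) (hxκ b))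
    (fun b _ => by
      simp only [hg]
      rw [Complex.norm_real, Real.norm_of_nonneg (Real.exp_nonneg _)]
      exact Real.exp_le_exp.2 (neg_le_neg (hmle b)))
  have hsm : ∑ b, m b = 2 * Real.pi ^ 2 * q * (1 - κ) * ‖y‖ ^ 2 := by
    simp only [hm]; rw [← Finset.mul_sum, ← hu y]
  rw [hprod, hsm] at h
  refine h.trans ?_
  have hmone : ∀ b, Real.exp (m b) ≤ 3 := fun b => by
    have h1 : m b ≤ 1 := by
      refine (hmle b).trans ?_
      have h2 : x b ^ 2 ≤ 1 / 64 := by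
        rw [← sq_abs]
        have := hx8 b
        nlinarith [abs_nonneg (x b)]
      calc 2 * Real.pi ^ 2 * q * x b ^ 2 ≤ 2 * 10 * (1 / 4) * (1 / 64) := by gcongr
        _ ≤ 1 := by norm_num
    exact (Real.exp_le_exp.2 h1).trans (by linarith [Real.exp_one_lt_d9])
  have hxb : ∀ b, |x b| ≤ √(d / N) * ‖y‖ := fun b => by
    refine (abs_real_inner_le_norm _ _).trans ?_
    gcongr
    exact Real.le_sqrt_of_sq_le (hK b)
  -- the cubic error, summed over `B`
  have hsum : ∑ b, Real.exp (m b) * ‖centeredChar p (x b) - g b‖ ≤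
      300 * (q * √(d / N) * ‖y‖ ^ 3) := by
    calc ∑ b, Real.exp (m b) * ‖centeredChar p (x b) - g b‖
        ≤ ∑ b, 3 * (100 * q * (√(d / N) * ‖y‖ * x b ^ 2)) := by
          refine Finset.sum_le_sum fun b _ => ?_
          have h1 := norm_centeredChar_sub_le hp₀.le hp₁.le (hx8 b)
          have h2 : |x b| ^ 3 ≤ √(d / N) * ‖y‖ * x b ^ 2 := by
            rw [pow_succ, sq_abs, mul_comm]
            exact mul_le_mul_of_nonneg_right (hxb b) (sq_nonneg _)
          have h3 : ‖centeredChar p (x b) - g b‖ ≤ 100 * q * (√(d / N) * ‖y‖ * x b ^ 2) :=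
            h1.trans (mul_le_mul_of_nonneg_left h2 (by positivity))
          exact mul_le_mul (hmone b) h3 (norm_nonneg _) (by norm_num)
      _ = 300 * (q * √(d / N) * ‖y‖ ^ 3) := by
          rw [← Finset.mul_sum, ← Finset.mul_sum, ← Finset.mul_sum, hu y]; ring
  -- the factor `t ^ (3 / 2)` is absorbed by `exp t`
  have habs : q * √(d / N) * ‖y‖ ^ 3 ≤
      2 * d ^ 2 / √(q * N) * Real.exp (2 * Real.pi ^ 2 * q * κ * ‖y‖ ^ 2) := by
    set t := 2 * Real.pi ^ 2 * q * κ * ‖y‖ ^ 2 with ht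
    have ht0 : 0 ≤ t := by positivity
    set r := √q * ‖y‖ with hr
    have hr0 : 0 ≤ r := by positivity
    have hr2 : r ^ 2 ≤ d * t := by
      have e1 : r ^ 2 = q * ‖y‖ ^ 2 := by rw [hr, mul_pow, Real.sq_sqrt hq.le]
      have e2 : d * t = Real.pi ^ 2 / 2 * (q * ‖y‖ ^ 2) := by
        rw [ht, hκ]; field_simp; ring
      rw [e1, e2]
      have : 0 ≤ q * ‖y‖ ^ 2 := by positivity
      nlinarith
    have e3 : q * √(d / N) * ‖y‖ ^ 3 = √d * r ^ 3 / √(q * N) := by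
      rw [hr, Real.sqrt_div hd0.le, Real.sqrt_mul hq.le, mul_pow]
      have h1 : √q ≠ 0 := (Real.sqrt_pos.2 hq).ne'
      have h2 : √N ≠ 0 := (Real.sqrt_pos.2 hN).ne'
      have h3 : √q ^ 2 = q := Real.sq_sqrt hq.le
      field_simp
      rw [h3, mul_comm]
    rw [e3, div_mul_eq_mul_div]
    refine div_le_div_of_nonneg_right ?_ (Real.sqrt_nonneg _)
    have h4 : √d * r ≤ d * (1 + t) := by
      apply abs_le_of_sq_le_sq' _ (by positivity) |>.2
      rw [mul_pow, Real.sq_sqrt hd0.le]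
      nlinarith [mul_le_mul_of_nonneg_left hr2 hd0.le, sq_nonneg t, sq_nonneg d,
        mul_nonneg (sq_nonneg d) ht0, mul_nonneg (sq_nonneg d) (sq_nonneg t)]
    have h5 : √d * r ^ 3 ≤ d * (1 + t) * (d * t) := by
      calc √d * r ^ 3 = (√d * r) * r ^ 2 := by ring
        _ ≤ d * (1 + t) * (d * t) := by gcongr
    have h6 := Real.quadratic_le_exp_of_nonneg ht0
    have h7 : (1 + t) * t ≤ 2 * Real.exp t := by nlinarith
    calc √d * r ^ 3 ≤ d * (1 + t) * (d * t) := h5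
      _ = d ^ 2 * ((1 + t) * t) := by ring
      _ ≤ d ^ 2 * (2 * Real.exp t) := by gcongr
      _ = 2 * d ^ 2 * Real.exp t := by ring
  calc Real.exp (-(2 * Real.pi ^ 2 * q * (1 - κ) * ‖y‖ ^ 2)) *
        ∑ b, Real.exp (m b) * ‖centeredChar p (x b) - g b‖
      ≤ Real.exp (-(2 * Real.pi ^ 2 * q * (1 - κ) * ‖y‖ ^ 2)) *
        (300 * (2 * d ^ 2 / √(q * N) * Real.exp (2 * Real.pi ^ 2 * q * κ * ‖y‖ ^ 2))) := by
        gcongr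
        exact hsum.trans (by gcongr)
    _ = 600 * d ^ 2 / √(q * N) * (Real.exp (-(2 * Real.pi ^ 2 * q * (1 - κ) * ‖y‖ ^ 2)) *
          Real.exp (2 * Real.pi ^ 2 * q * κ * ‖y‖ ^ 2)) := by ring
    _ = _ := by
        rw [← Real.exp_add]
        congr 2
        rw [hκ]
        field_simp
        ring

variable [FiniteDimensional ℝ E] [MeasurableSpace E] [BorelSpace E]

theorem integral_exp_neg_widened_le {d : ℕ} (hd : 1 ≤ d) (hE : finrank ℝ E = d) {q : ℝ}
    (hq : 0 < q) :
    ∫ y : E, Real.exp (-(2 * Real.pi ^ 2 * q * (1 - 1 / (2 * d)) * ‖y‖ ^ 2)) ≤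
      2 / (2 * Real.pi * q) ^ ((d : ℝ) / 2) := by
  have hd1 : (1 : ℝ) ≤ d := by exact_mod_cast hd
  have hpi := Real.pi_pos
  set r : ℝ := 1 - 1 / (2 * d) with hr
  have hr2 : 1 / 2 ≤ r := by
    have : 1 / (2 * (d : ℝ)) ≤ 1 / 2 := by
      apply one_div_le_one_div_of_le <;> linarith
    rw [hr]; linarith
  have hr0 : 0 < r := by linarith
  have h := GaussianFourier.integral_rexp_neg_mul_sq_norm (V := E) (b := 2 * Real.pi ^ 2 * q * r)
    (by positivity)
  simp only [neg_mul] at h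
  rw [h, hE]
  have e : Real.pi / (2 * Real.pi ^ 2 * q * r) = (2 * Real.pi * q)⁻¹ * r⁻¹ := by
    field_simp
  rw [e, Real.mul_rpow (by positivity) (by positivity), Real.inv_rpow (by positivity),
    Real.inv_rpow hr0.le, div_eq_mul_inv, mul_comm]
  refine mul_le_mul_of_nonneg_right ?_ (by positivity)
  rw [inv_le_comm₀ (by positivity) (by norm_num)]
  -- Bernoulli's inequality
  have h1 : 1 / 2 ≤ r ^ d := by
    have := one_add_mul_le_pow (a := -(1 / (2 * (d : ℝ)))) (by linarith) d
    refine le_trans (le_of_eq ?_) (this.trans (le_of_eq (by rw [hr, sub_eq_add_neg])))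
    field_simp
    norm_num
  have h2 : r ^ d ≤ r ^ ((d : ℝ) / 2) := by
    rw [← Real.rpow_natCast]
    apply Real.rpow_le_rpow_of_exponent_ge hr0
    · rw [hr]
      have : 0 ≤ 1 / (2 * (d : ℝ)) := by positivity
      linarith
    · linarith
  exact (one_div (2 : ℝ)).symm.le.trans (h1.trans h2)

theorem integral_gaussian_mul_exp_inner {d : ℕ} (hE : finrank ℝ E = d) {q : ℝ}
    (hq : 0 < q) (w : E) :
    ∫ y : E, (Real.exp (-(2 * Real.pi ^ 2 * q * ‖y‖ ^ 2)) : ℂ) *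
        Complex.exp (-(2 * Real.pi * ⟪w, y⟫) * Complex.I) =
      ((Real.exp (-(‖w‖ ^ 2 / (2 * q))) / (2 * Real.pi * q) ^ ((d : ℝ) / 2) : ℝ) : ℂ) := by
  have hpi := Real.pi_pos
  have hb : 0 < ((2 * Real.pi ^ 2 * q : ℝ) : ℂ).re := by
    rw [Complex.ofReal_re]; positivity
  have h := GaussianFourier.integral_cexp_neg_mul_sq_norm_add hb (-(2 * Real.pi) * Complex.I) w
  have e : ∀ y : E, (Real.exp (-(2 * Real.pi ^ 2 * q * ‖y‖ ^ 2)) : ℂ) *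
        Complex.exp (-(2 * Real.pi * ⟪w, y⟫) * Complex.I) =
      Complex.exp (-((2 * Real.pi ^ 2 * q : ℝ) : ℂ) * ‖y‖ ^ 2 +
        -(2 * Real.pi) * Complex.I * ⟪w, y⟫) := fun y => by
    rw [Complex.ofReal_exp, ← Complex.exp_add]
    congr 1
    push_cast
    ring
  simp_rw [e]
  rw [h, hE]
  have e1 : (Real.pi : ℂ) / ((2 * Real.pi ^ 2 * q : ℝ) : ℂ) = ((2 * Real.pi * q)⁻¹ : ℝ) := by
    push_cast
    have : (Real.pi : ℂ) ≠ 0 := by exact_mod_cast hpi.ne'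
    have : (q : ℂ) ≠ 0 := by exact_mod_cast hq.ne'
    field_simp
  have e2 : ((d : ℕ) / 2 : ℂ) = (((d : ℝ) / 2 : ℝ) : ℂ) := by push_cast; rfl
  rw [e1, e2, ← Complex.ofReal_cpow (by positivity), Real.inv_rpow (by positivity)]
  have e3 : (-(2 * Real.pi) * Complex.I) ^ 2 * (‖w‖ : ℂ) ^ 2 / (4 * ((2 * Real.pi ^ 2 * q : ℝ) : ℂ))
      = ((-(‖w‖ ^ 2 / (2 * q)) : ℝ) : ℂ) := by
    push_cast
    have : (Real.pi : ℂ) ≠ 0 := by exact_mod_cast hpi.ne'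
    have : (q : ℂ) ≠ 0 := by exact_mod_cast hq.ne'
    rw [mul_pow, Complex.I_sq]
    field_simp
    ring
  rw [e3, ← Complex.ofReal_exp]
  push_cast
  rw [mul_comm, ← div_eq_mul_inv]

/-- The contribution of a neighbourhood of the origin to the inversion formula is the Gaussian
density, up to an error controlled by the incoherence `‖u b‖² ≤ d / N` of the frame. -/
theorem norm_setIntegral_sub_gaussian_le {d : ℕ} (hd : 1 ≤ d) (hE : finrank ℝ E = d)
    {u : B → E} {p N ε : ℝ} (hp₀ : 0 < p) (hp₁ : p < 1) (hN : 0 < N)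
    (hu : ∀ y, ∑ b, ⟪u b, y⟫ ^ 2 = ‖y‖ ^ 2) (hK : ∀ b, ‖u b‖ ^ 2 ≤ d / N)
    (hε₁ : 0 < ε) (hε₀ : ε ≤ 1 / 8) (hε : 64 * d * ε ^ 2 ≤ 1) (γ : B → ℝ) :
    ‖(∫ y in {y : E | ∀ b, |⟪u b, y⟫| < ε}, (∏ b, bernoulliChar p ⟪u b, y⟫) *
          Complex.exp (-(2 * Real.pi * ∑ b, (γ b : ℂ) * ⟪u b, y⟫) * Complex.I)) -
        ((Real.exp (-(‖∑ b, (γ b - p) • u b‖ ^ 2 / (2 * (p * (1 - p))))) /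
          (2 * Real.pi * (p * (1 - p))) ^ ((d : ℝ) / 2) : ℝ) : ℂ)‖ ≤
      (600 * d ^ 2 / √(p * (1 - p) * N) + Real.exp (-(p * (1 - p) * N * ε ^ 2 / d ^ 2))) *
        (2 / (2 * Real.pi * (p * (1 - p))) ^ ((d : ℝ) / 2)) := by
  set q := p * (1 - p) with hqdef
  have hq : 0 < q := mul_pos hp₀ (by linarith)
  have hpi := Real.pi_pos
  have hpi3 : 3.14 < Real.pi := Real.pi_gt_d2
  have hd1 : (1 : ℝ) ≤ d := by exact_mod_cast hd
  set w := ∑ b, (γ b - p) • u b with hw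
  set Z : Set E := {y : E | ∀ b, |⟪u b, y⟫| < ε} with hZ
  have hZm : MeasurableSet Z := by
    have : Z = ⋂ b, {y : E | |⟪u b, y⟫| < ε} := by ext; simp [hZ]
    rw [this]
    exact MeasurableSet.iInter fun b => (isOpen_lt (by fun_prop) (by fun_prop)).measurableSet
  have hww : ∀ y : E, ⟪w, y⟫ = ∑ b, (γ b - p) * ⟪u b, y⟫ := fun y => by
    rw [hw, sum_inner]
    exact Finset.sum_congr rfl fun b _ => by rw [real_inner_smul_left]
  set G : E → ℂ := fun y => (Real.exp (-(2 * Real.pi ^ 2 * q * ‖y‖ ^ 2)) : ℂ) *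
        Complex.exp (-(2 * Real.pi * ⟪w, y⟫) * Complex.I) with hG
  set F : E → ℂ := fun y => (∏ b, bernoulliChar p ⟪u b, y⟫) *
          Complex.exp (-(2 * Real.pi * ∑ b, (γ b : ℂ) * ⟪u b, y⟫) * Complex.I) with hF
  have hFc : ∀ y, F y = (∏ b, centeredChar p ⟪u b, y⟫) *
      Complex.exp (-(2 * Real.pi * ⟪w, y⟫) * Complex.I) := fun y => by
    simp only [hF, centeredChar]
    rw [Finset.prod_mul_distrib, mul_assoc _ (∏ b, Complex.exp _), ← Complex.exp_sum,
      ← Complex.exp_add]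
    congr 2
    rw [hww y, ← Finset.sum_mul, ← add_mul]
    congr 1
    push_cast
    rw [Finset.sum_neg_distrib, ← neg_add, ← Finset.mul_sum, ← mul_add, ← Finset.sum_add_distrib]
    congr 2
    refine Finset.sum_congr rfl fun b _ => by ring
  have hnexp : ∀ y : E, ‖Complex.exp (-(2 * Real.pi * ⟪w, y⟫) * Complex.I)‖ = 1 := fun y => by
    have h : (-(2 * Real.pi * ⟪w, y⟫) * Complex.I : ℂ) =
      ((-(2 * Real.pi * ⟪w, y⟫) : ℝ) : ℂ) * Complex.I := by push_cast; ring
    rw [h, Complex.norm_exp_ofReal_mul_I]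
  set W : E → ℝ := fun y => Real.exp (-(2 * Real.pi ^ 2 * q * (1 - 1 / (2 * d)) * ‖y‖ ^ 2)) with hW
  set α : ℝ := 600 * d ^ 2 / √(q * N) with hα
  set β : ℝ := Real.exp (-(q * N * ε ^ 2 / d ^ 2)) with hβ
  have hα0 : 0 ≤ α := by positivity
  have hβ0 : 0 ≤ β := by positivity
  have hr0 : 0 < 1 - 1 / (2 * (d : ℝ)) := by
    have : 1 / (2 * (d : ℝ)) ≤ 1 / 2 := by
      apply one_div_le_one_div_of_le <;> linarith
    linarith
  have hcont : Continuous F := by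
    simp only [hF]
    have := continuous_bernoulliChar p
    fun_prop
  have hWint : Integrable W := by
    have h := GaussianFourier.integrable_cexp_neg_mul_sq_norm_add (V := E)
      (b := ((2 * Real.pi ^ 2 * q * (1 - 1 / (2 * d)) : ℝ) : ℂ))
      (by rw [Complex.ofReal_re]; positivity) 0 0
    refine h.re.congr (Filter.Eventually.of_forall fun y => ?_)
    simp only [hW]
    rw [zero_mul, add_zero, ← Complex.ofReal_neg, ← Complex.ofReal_pow, ← Complex.ofReal_mul,
      ← Complex.ofReal_exp, neg_mul]
    rfl
  have hGint : Integrable G := by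
    have h := GaussianFourier.integrable_cexp_neg_mul_sq_norm_add (V := E)
      (b := ((2 * Real.pi ^ 2 * q : ℝ) : ℂ))
      (by rw [Complex.ofReal_re]; positivity) (-(2 * Real.pi) * Complex.I) w
    refine h.congr (Filter.Eventually.of_forall fun y => ?_)
    simp only [hG]
    rw [Complex.ofReal_exp, ← Complex.exp_add]
    congr 1
    push_cast
    ring
  have hpt : ∀ y, ‖Z.indicator F y - G y‖ ≤ (α + β) * W y := fun y => by
    have hW0 : 0 ≤ W y := Real.exp_nonneg _
    by_cases hy : y ∈ Z
    · rw [Set.indicator_of_mem hy, hFc, hG, ← sub_mul, norm_mul, hnexp, mul_one]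
      refine (norm_prod_centeredChar_sub_le hp₀ hp₁ hd1 hN hu hK hε₀ hε hy).trans ?_
      nlinarith [mul_nonneg hβ0 hW0]
    · rw [Set.indicator_of_notMem hy, zero_sub, norm_neg, hG, norm_mul, hnexp, mul_one,
        Complex.norm_real, Real.norm_of_nonneg (Real.exp_nonneg _)]
      simp only [hZ, Set.mem_ofPred_eq, not_forall, not_lt] at hy
      obtain ⟨b, hb⟩ := hy
      have h1 : ε ^ 2 ≤ d / N * ‖y‖ ^ 2 := by
        calc ε ^ 2 ≤ |⟪u b, y⟫| ^ 2 := pow_le_pow_left₀ hε₁.le hb 2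
          _ ≤ (‖u b‖ * ‖y‖) ^ 2 :=
            pow_le_pow_left₀ (abs_nonneg _) (abs_real_inner_le_norm _ _) 2
          _ = ‖u b‖ ^ 2 * ‖y‖ ^ 2 := mul_pow _ _ _
          _ ≤ d / N * ‖y‖ ^ 2 := by gcongr; exact hK b
      have h2 : Real.exp (-(2 * Real.pi ^ 2 * q * ‖y‖ ^ 2)) ≤ β * W y := by
        simp only [hβ, hW]
        rw [← Real.exp_add, Real.exp_le_exp]
        have h3 : q * N * ε ^ 2 / d ^ 2 ≤ q * ‖y‖ ^ 2 / d := by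
          calc q * N * ε ^ 2 / d ^ 2 ≤ q * N * (d / N * ‖y‖ ^ 2) / d ^ 2 := by gcongr
            _ = q * ‖y‖ ^ 2 / d := by field_simp
        have h4 : 2 * Real.pi ^ 2 * q * (1 - 1 / (2 * d)) * ‖y‖ ^ 2 =
            2 * Real.pi ^ 2 * q * ‖y‖ ^ 2 - Real.pi ^ 2 * (q * ‖y‖ ^ 2 / d) := by
          field_simp
        have h5 : 0 ≤ q * ‖y‖ ^ 2 / d := by positivity
        have h6 : 1 ≤ Real.pi ^ 2 := by nlinarith
        rw [h4]
        nlinarith [mul_le_mul_of_nonneg_right h6 h5]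
      nlinarith [mul_nonneg hα0 hW0]
  have hFint : Integrable (Z.indicator F) := by
    have h1 : Integrable (fun y => Z.indicator F y - G y) :=
      (hWint.const_mul (α + β)).mono'
        ((hcont.aestronglyMeasurable.indicator hZm).sub hGint.aestronglyMeasurable)
        (Filter.Eventually.of_forall hpt)
    refine (h1.add hGint).congr (Filter.Eventually.of_forall fun y => ?_)
    simp
  rw [← integral_gaussian_mul_exp_inner hE hq w, ← integral_indicator hZm,
    ← integral_sub hFint hGint]
  refine (norm_integral_le_of_norm_le (hWint.const_mul (α + β))
    (Filter.Eventually.of_forall hpt)).trans ?_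
  rw [integral_const_mul]
  gcongr
  exact integral_exp_neg_widened_le hd hE hq

end Frame

/-! ### Integer bases -/

section IntegerBasis

variable {B : Type*} [Fintype B] {V : Submodule ℚ (B → ℚ)}

/-- Every subspace `V` has a basis of integer-valued functions such that the rows of the resulting
integer matrix generate the whole lattice `ℤⁿ`. It is dual to a `ℤ`-basis of the lattice generated
by the evaluation functionals in the dual space of `V`. -/
theorem exists_integer_basis (V : Submodule ℚ (B → ℚ)) :
    ∃ (n : ℕ) (φ : Basis (Fin n) ℚ V) (Φ : B → Fin n → ℤ),
      (∀ a b, (φ a : B → ℚ) b = Φ b a) ∧ Submodule.span ℤ (Set.range Φ) = ⊤ := by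
  let ev : B → Dual ℚ V := fun b => (LinearMap.proj b : (B → ℚ) →ₗ[ℚ] ℚ) ∘ₗ V.subtype
  have hev : Submodule.span ℚ (Set.range ev) = ⊤ := by
    refine Submodule.span_eq_top_of_ne_zero fun z hz => ?_
    by_contra! h
    refine hz (Subtype.ext (funext fun b => ?_))
    exact h _ ⟨b, rfl⟩
  let L : Submodule ℤ (Dual ℚ V) := Submodule.span ℤ (Set.range ev)
  have : Module.Finite ℤ L := Module.Finite.span_of_finite ℤ (Set.finite_range ev)
  have : IsTorsionFree ℤ (Dual ℚ V) := inferInstance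
  have : Module.Free ℤ L := inferInstance
  let n := finrank ℤ L
  let β : Basis (Fin n) ℤ L := finBasis ℤ L
  have hli : LinearIndependent ℚ (fun i => (β i : Dual ℚ V)) := by
    rw [← LinearIndependent.iff_fractionRing (R := ℤ)]
    exact β.linearIndependent.map' L.subtype (Submodule.ker_subtype L)
  have hrep : ∀ x : L, (x : Dual ℚ V) = ∑ i, β.repr x i • (β i : Dual ℚ V) := fun x => by
    have h := congrArg (fun y : L => (y : Dual ℚ V)) (β.sum_repr x)
    simpa [-Basis.sum_repr] using h.symm
  have hmem : ∀ b, ev b ∈ L := fun b => Submodule.subset_span ⟨b, rfl⟩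
  have hsp : ⊤ ≤ Submodule.span ℚ (Set.range fun i => (β i : Dual ℚ V)) := by
    rw [← hev, Submodule.span_le]
    rintro _ ⟨b, rfl⟩
    rw [SetLike.mem_coe, show ev b = _ from hrep ⟨ev b, hmem b⟩]
    refine Submodule.sum_mem _ fun i _ => ?_
    rw [← Int.cast_smul_eq_zsmul ℚ]
    exact Submodule.smul_mem _ _ (Submodule.subset_span ⟨i, rfl⟩)
  let b' : Basis (Fin n) ℚ (Dual ℚ V) := Basis.mk hli hsp
  let φ : Basis (Fin n) ℚ V := b'.dualBasis.map (evalEquiv ℚ V).symm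
  have hφ : ∀ i j, (β i : Dual ℚ V) (φ j) = if i = j then 1 else 0 := fun i j => by
    have h1 : (β i : Dual ℚ V) = b' i := by simp [b']
    have h2 : b' i (φ j) = b'.dualBasis j (b' i) := by
      change evalEquiv ℚ V (φ j) (b' i) = _
      simp only [φ, Basis.map_apply, LinearEquiv.apply_symm_apply]
    rw [h1, h2, Basis.dualBasis_apply_self]
  refine ⟨n, φ, fun b a => β.repr ⟨ev b, hmem b⟩ a, fun a b => ?_, ?_⟩
  · have h := congrArg (fun x : Dual ℚ V => x (φ a)) (hrep ⟨ev b, hmem b⟩)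
    simp only [LinearMap.coe_sum, Finset.sum_apply, LinearMap.smul_apply, hφ] at h
    have h0 : ev b (φ a) = (φ a : B → ℚ) b := rfl
    rw [← h0, h]
    simp
  · have h1 : Submodule.span ℤ (Set.range fun b => (⟨ev b, hmem b⟩ : L)) = ⊤ := by
      have := Submodule.span_span_coe_preimage (R := ℤ) (s := Set.range ev)
      rw [← this]
      congr 1
      ext x
      constructor
      · rintro ⟨b, rfl⟩
        exact ⟨b, rfl⟩
      · rintro ⟨b, hb⟩
        exact ⟨b, Subtype.ext hb⟩
    have h2 := congrArg (Submodule.map (β.equivFun : L →ₗ[ℤ] (Fin n → ℤ))) h1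
    rw [Submodule.map_span, ← Set.range_comp, Submodule.map_top, LinearEquiv.range] at h2
    exact h2

variable {n : ℕ} {φ : Basis (Fin n) ℚ V} {Φ : B → Fin n → ℤ}

omit [Fintype B] in
/-- The lattice `ℤⁿ` is self-dual, phrased for a generating family of integer vectors. -/
theorem exists_intCast_of_span_eq_top (hΦ : Submodule.span ℤ (Set.range Φ) = ⊤) {θ : Fin n → ℝ}
    (h : ∀ b, ∃ k : ℤ, ∑ a, (Φ b a : ℝ) * θ a = k) (a : Fin n) : ∃ k : ℤ, θ a = k := by
  have key : ∀ v ∈ Submodule.span ℤ (Set.range Φ), ∃ k : ℤ, ∑ a, (v a : ℝ) * θ a = k := by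
    intro v hv
    induction hv using Submodule.span_induction with
    | mem x hx => obtain ⟨b, rfl⟩ := hx; exact h b
    | zero => exact ⟨0, by simp⟩
    | add x y _ _ hx hy =>
      obtain ⟨k, hk⟩ := hx
      obtain ⟨l, hl⟩ := hy
      exact ⟨k + l, by simp [add_mul, Finset.sum_add_distrib, hk, hl]⟩
    | smul c x _ hx =>
      obtain ⟨k, hk⟩ := hx
      exact ⟨c * k, by simp [mul_assoc, ← Finset.mul_sum, hk]⟩
  obtain ⟨k, hk⟩ := key (Pi.single a 1) (by rw [hΦ]; trivial)
  refine ⟨k, ?_⟩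
  rw [← hk]
  simp [Pi.single_apply]

omit [Fintype B] in
theorem basisMatrix_eq_intCast (hφ : ∀ a b, (φ a : B → ℚ) b = Φ b a) (b : B) (a : Fin n) :
    basisMatrix φ b a = Φ b a := by
  simp [basisMatrix, hφ]

omit [Fintype B] in
theorem rowLattice_eq_span_basisFun (hφ : ∀ a b, (φ a : B → ℚ) b = Φ b a)
    (hΦ : Submodule.span ℤ (Set.range Φ) = ⊤) :
    rowLattice φ = Submodule.span ℤ (Set.range (Pi.basisFun ℝ (Fin n))) := by
  let ι : (Fin n → ℤ) →ₗ[ℤ] (Fin n → ℝ) := (Int.castAddHom ℝ).toIntLinearMap.compLeft (Fin n)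
  have h1 : rowLattice φ = (Submodule.span ℤ (Set.range Φ)).map ι := by
    rw [Submodule.map_span, ← Set.range_comp, rowLattice]
    congr 2
    funext b a
    exact basisMatrix_eq_intCast hφ b a
  have h2 : Submodule.span ℤ (Set.range (Pi.basisFun ℝ (Fin n))) =
      (Submodule.span ℤ (Set.range (Pi.basisFun ℤ (Fin n)))).map ι := by
    rw [Submodule.map_span, ← Set.range_comp]
    congr 2
    funext a a'
    simp [ι, Pi.single_apply]
  rw [h1, h2, hΦ, (Pi.basisFun ℤ (Fin n)).span_eq]

theorem rho_eq_inv_sqrt_det (hφ : ∀ a b, (φ a : B → ℚ) b = Φ b a)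
    (hΦ : Submodule.span ℤ (Set.range Φ) = ⊤) :
    rho V = 1 / √(((basisMatrix φ)ᵀ * basisMatrix φ).det) := by
  rw [rho_eq φ]
  congr 1
  have h := ZSpan.isAddFundamentalDomain (Pi.basisFun ℝ (Fin n)) MeasureTheory.volume
  have h' : MeasureTheory.IsAddFundamentalDomain (rowLattice φ)
      (ZSpan.fundamentalDomain (Pi.basisFun ℝ (Fin n))) MeasureTheory.volume := by
    rw [rowLattice_eq_span_basisFun hφ hΦ]
    exact h
  rw [ZLattice.covolume_eq_measure_fundamentalDomain _ _ h', ZSpan.fundamentalDomain_pi_basisFun,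
    MeasureTheory.measureReal_def, MeasureTheory.volume_pi, MeasureTheory.Measure.pi_pi]
  simp

/-- A space with a bounded integer basis in `ℓ_∞` has a basis of bounded integer functions. -/
theorem exists_bounded_basis {c : ℕ} (h : HasBoundedIntegerBasis lInftyNorm c V)
    (φ : Basis (Fin n) ℚ V) :
    ∃ (ψ : Basis (Fin n) ℚ V) (g : Fin n → B → ℤ), (∀ a b, (ψ a : B → ℚ) b = g a b) ∧
      ∀ a b, |g a b| ≤ c := by
  have hn : finrank ℚ V = n := by rw [finrank_eq_card_basis φ, Fintype.card_fin]
  unfold HasBoundedIntegerBasis at h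
  set S : Set (B → ℚ) :=
    {g : B → ℚ | g ∈ V ∧ ∃ γ : B → ℤ, lInftyNorm γ ≤ c ∧ ∀ b, g b = (γ b : ℚ)} with hS
  obtain ⟨f, hfS, hfspan, hfli⟩ := Submodule.exists_fun_fin_finrank_span_eq ℚ S
  have hcard : finrank ℚ (Submodule.span ℚ S) = n := by rw [h, hn]
  choose hfV g hg hfg using hfS
  let f' : Fin (finrank ℚ (Submodule.span ℚ S)) → V := fun i => ⟨f i, hfV i⟩
  have hli : LinearIndependent ℚ f' := LinearIndependent.of_comp V.subtype hfli
  have hsp : ⊤ ≤ Submodule.span ℚ (Set.range f') := by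
    rw [← Submodule.map_le_map_iff_of_injective V.subtype_injective, Submodule.map_span,
      ← Set.range_comp, Submodule.map_subtype_top]
    have : V.subtype ∘ f' = f := rfl
    rw [this, hfspan, h]
  refine ⟨(Basis.mk hli hsp).reindex (finCongr hcard), fun a => g ((finCongr hcard).symm a),
    fun a b => ?_, fun a b => ?_⟩
  · rw [Basis.reindex_apply, Basis.mk_apply]
    exact hfg _ b
  · have h1 := hg ((finCongr hcard).symm a)
    have h2 : (g ((finCongr hcard).symm a) b).natAbs ≤ c :=
      (Finset.le_sup (f := fun b => (g ((finCongr hcard).symm a) b).natAbs)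
        (Finset.mem_univ b)).trans h1
    rw [Int.abs_eq_natAbs]
    exact_mod_cast h2

/-- The determinant of the Gram matrix of an integer basis that generates the dual lattice is
bounded by that of any other integer basis, hence by the Leibniz formula for a bounded one. -/
theorem det_gram_le {c : ℕ} (h : HasBoundedIntegerBasis lInftyNorm c V)
    (hφ : ∀ a b, (φ a : B → ℚ) b = Φ b a) (hΦ : Submodule.span ℤ (Set.range Φ) = ⊤) :
    ((basisMatrix φ)ᵀ * basisMatrix φ).det ≤ (n * (c ^ 2 * Fintype.card B)) ^ n := by
  obtain ⟨ψ, g, hψ, hg⟩ := exists_bounded_basis h φ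
  set M := basisMatrix φ with hM
  set Q := changeMatrix φ ψ with hQ
  have hMQ : basisMatrix ψ = M * Q := (basisMatrix_mul φ ψ).symm
  have hψg : ∀ b a, basisMatrix ψ b a = g a b := fun b a => by simp [basisMatrix, hψ]
  -- the coordinates of integer functions of `V` are integers
  have hQint : ∀ a a', ∃ k : ℤ, Q a a' = k := fun a a' => by
    refine exists_intCast_of_span_eq_top hΦ (θ := fun a => Q a a') (fun b => ⟨g a' b, ?_⟩) a
    rw [← hψg, hMQ, Matrix.mul_apply]
    simp only [hM, basisMatrix_eq_intCast hφ]
  choose K hK using hQint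
  have hQK : Q = (Matrix.of K).map (Int.castRingHom ℝ) := by
    ext a a'
    simp [hK]
  have hdetQ : Q.det = ((Matrix.of K).det : ℤ) := by
    rw [hQK, ← RingHom.mapMatrix_apply, ← RingHom.map_det]
    simp
  have hQ0 : Q.det ≠ 0 := fun h0 => by
    have := congrArg Matrix.det (changeMatrix_mul φ ψ)
    rw [Matrix.det_mul, ← hQ, h0] at this
    simp at this
  have hQ1 : 1 ≤ Q.det ^ 2 := by
    rw [hdetQ] at hQ0 ⊢
    have : (Matrix.of K).det ≠ 0 := by exact_mod_cast hQ0
    have : 0 < (Matrix.of K).det ^ 2 := by positivity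
    exact_mod_cast this
  have hpos : 0 ≤ (Mᵀ * M).det := by
    have := (Matrix.posSemidef_conjTranspose_mul_self M).det_nonneg
    simpa using this
  have hdet : ((basisMatrix ψ)ᵀ * basisMatrix ψ).det = (Mᵀ * M).det * Q.det ^ 2 := by
    rw [hMQ, Matrix.transpose_mul, Matrix.mul_assoc, ← Matrix.mul_assoc Mᵀ, Matrix.det_mul,
      Matrix.det_mul, Matrix.det_transpose]
    ring
  have hent : ∀ i j, |((basisMatrix ψ)ᵀ * basisMatrix ψ) i j| ≤ c ^ 2 * Fintype.card B := by
    intro i j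
    rw [Matrix.mul_apply]
    refine (Finset.abs_sum_le_sum_abs _ _).trans ?_
    have : ∀ b ∈ Finset.univ, |(basisMatrix ψ)ᵀ i b * basisMatrix ψ b j| ≤ (c : ℝ) ^ 2 := by
      intro b _
      rw [Matrix.transpose_apply, hψg, hψg, abs_mul, sq]
      have h1 : |(g i b : ℝ)| ≤ c := by exact_mod_cast hg i b
      have h2 : |(g j b : ℝ)| ≤ c := by exact_mod_cast hg j b
      gcongr
    refine (Finset.sum_le_card_nsmul _ _ _ this).trans (le_of_eq ?_)
    simp [mul_comm]
  have hle := Matrix.det_le (abv := AbsoluteValue.abs) hent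
  rw [AbsoluteValue.abs_apply, Fintype.card_fin, nsmul_eq_mul] at hle
  calc (Mᵀ * M).det ≤ (Mᵀ * M).det * Q.det ^ 2 := le_mul_of_one_le_right hpos hQ1
    _ ≤ (n.factorial : ℝ) * (c ^ 2 * Fintype.card B) ^ n := by
        rw [← hdet]; exact (le_abs_self _).trans hle
    _ ≤ (n : ℝ) ^ n * (c ^ 2 * Fintype.card B) ^ n := by
        gcongr
        exact_mod_cast Nat.factorial_le_pow n
    _ = _ := (mul_pow _ _ _).symm

end IntegerBasis

/-! ### Integer relations and symmetries -/

section Relations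

variable {B : Type*} [Fintype B] {V : Submodule ℚ (B → ℚ)}

theorem mem_of_forall_orthogonalComplement {f : B → ℚ}
    (h : ∀ g ∈ orthogonalComplement V, ∑ b, f b * g b = 0) : f ∈ V := by
  classical
  by_contra hf
  obtain ⟨l, hl, hV⟩ := Submodule.exists_le_ker_of_notMem hf
  have hsum : ∀ f : B → ℚ, l f = ∑ b, f b * l (Pi.single b 1) := fun f => by
    conv_lhs => rw [pi_eq_sum_univ' f, map_sum]
    simp only [map_smul, smul_eq_mul]
  refine hl ?_
  rw [hsum]
  refine h _ fun f hf => ?_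
  rw [← hsum]
  exact hV hf

/-- If `f` is a real combination of elements of `V` whose values are all close to integers, then
rounding the values of `f` gives an element of `V`: the pairing of the rounded function with a
short integer vector of `V^⊥` is an integer of absolute value less than `1`. -/
theorem round_mem {c : ℕ} (h : HasBoundedIntegerBasis l1Norm c (orthogonalComplement V))
    {f : B → ℝ} (hf : ∀ g ∈ orthogonalComplement V, ∑ b, f b * g b = 0) {ε : ℝ}
    (hε : c * ε < 1) (hfε : ∀ b, |f b - round (f b)| ≤ ε) :
    (fun b => (round (f b) : ℚ)) ∈ V := by
  refine mem_of_forall_orthogonalComplement fun g hg => ?_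
  rw [← h] at hg
  induction hg using Submodule.span_induction with
  | zero => simp
  | add x y _ _ hx hy => simp [mul_add, Finset.sum_add_distrib, hx, hy]
  | smul a x _ hx =>
    have : ∀ b, (round (f b) : ℚ) * (a • x) b = a * ((round (f b) : ℚ) * x b) := fun b => by
      rw [Pi.smul_apply, smul_eq_mul]; ring
    simp only [this]
    rw [← Finset.mul_sum, hx, mul_zero]
  | mem g hg =>
    obtain ⟨hgV, γ, hγ, hgγ⟩ := hg
    have h1 : ∑ b, f b * γ b = 0 := by
      rw [← hf g hgV]
      exact Finset.sum_congr rfl fun b _ => by rw [hgγ]; simp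
    have h2 : |((∑ b, round (f b) * γ b : ℤ) : ℝ)| < 1 := by
      have e : ((∑ b, round (f b) * γ b : ℤ) : ℝ) = -∑ b, (f b - round (f b)) * γ b := by
        push_cast
        simp only [sub_mul, Finset.sum_sub_distrib, h1]
        ring
      rw [e, abs_neg]
      rcases isEmpty_or_nonempty B with hB | ⟨⟨b₀⟩⟩
      · simp
      have hε0 : 0 ≤ ε := (abs_nonneg _).trans (hfε b₀)
      calc |∑ b, (f b - round (f b)) * γ b| ≤ ∑ b, |(f b - round (f b)) * γ b| :=
            Finset.abs_sum_le_sum_abs _ _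
        _ ≤ ∑ b, ε * ((γ b).natAbs : ℝ) := by
            refine Finset.sum_le_sum fun b _ => ?_
            rw [abs_mul, Nat.cast_natAbs, Int.cast_abs]
            gcongr
            exact hfε b
        _ = (l1Norm γ : ℝ) * ε := by rw [← Finset.mul_sum, l1Norm, mul_comm]; push_cast; rfl
        _ ≤ c * ε := by gcongr
        _ < 1 := hε
    have h3 : ∑ b, round (f b) * γ b = 0 := by
      have : |∑ b, round (f b) * γ b| < 1 := by exact_mod_cast h2
      exact Int.abs_lt_one_iff.1 this
    have h4 : ∑ b, (round (f b) : ℚ) * (γ b : ℚ) = 0 := by exact_mod_cast h3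
    rw [← h4]
    exact Finset.sum_congr rfl fun b _ => by rw [hgγ]

/-- By the pigeonhole principle every sufficiently long tuple of points of `B` supports a nonzero
relation with coefficients in `{-1, 0, 1}` between the evaluations on `V`. -/
theorem exists_sign_relation {n c s : ℕ} (h : HasBoundedIntegerBasis lInftyNorm c V)
    (φ : Basis (Fin n) ℚ V) (hs : (2 * (s * c) + 1) ^ n < 2 ^ s) (x : Fin s → B) :
    ∃ k : Fin s → ℤ, k ≠ 0 ∧ (∀ i, |k i| ≤ 1) ∧ ∀ f ∈ V, ∑ i, (k i : ℚ) * f (x i) = 0 := by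
  classical
  obtain ⟨ψ, g, hψ, hg⟩ := exists_bounded_basis h φ
  let F : Finset (Fin s) → Fin n → ℤ := fun S a => ∑ i ∈ S, g a (x i)
  let T : Finset (Fin n → ℤ) :=
    Fintype.piFinset fun _ => Finset.Icc (-((s * c : ℕ) : ℤ)) ((s * c : ℕ) : ℤ)
  have hT : T.card = (2 * (s * c) + 1) ^ n := by
    simp only [T, Fintype.card_piFinset, Int.card_Icc, Finset.prod_const, Finset.card_univ,
      Fintype.card_fin]
    congr 1
    omega
  have hmaps : ∀ S ∈ (Finset.univ : Finset (Finset (Fin s))), F S ∈ T := by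
    intro S _
    simp only [T, Fintype.mem_piFinset, Finset.mem_Icc, F, ← abs_le]
    intro a
    calc |∑ i ∈ S, g a (x i)| ≤ ∑ i ∈ S, |g a (x i)| := Finset.abs_sum_le_sum_abs _ _
      _ ≤ ∑ i ∈ S, (c : ℤ) := Finset.sum_le_sum fun i _ => hg a (x i)
      _ = S.card * c := by simp
      _ ≤ ((s * c : ℕ) : ℤ) := by
        push_cast
        gcongr
        exact_mod_cast (Finset.card_le_univ S).trans (by simp)
  obtain ⟨S, -, S', -, hne, heq⟩ := Finset.exists_ne_map_eq_of_card_lt_of_maps_to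
    (by rw [hT, Finset.card_univ, Fintype.card_finset, Fintype.card_fin]; exact hs) hmaps
  refine ⟨fun i => (if i ∈ S then 1 else 0) - (if i ∈ S' then 1 else 0), fun h0 => hne ?_,
    fun i => ?_, fun f hf => ?_⟩
  · ext i
    have := congrFun h0 i
    by_cases h1 : i ∈ S <;> by_cases h2 : i ∈ S' <;> simp_all
  · by_cases h1 : i ∈ S <;> by_cases h2 : i ∈ S' <;> simp [h1, h2]
  · have hψ0 : ∀ a, ∑ i, (((if i ∈ S then 1 else 0) - (if i ∈ S' then 1 else 0) : ℤ) : ℚ) *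
        (ψ a : B → ℚ) (x i) = 0 := fun a => by
      have := congrFun heq a
      simp only [F] at this
      have h2 : ∑ i, ((if i ∈ S then 1 else 0) - (if i ∈ S' then 1 else 0) : ℤ) * g a (x i) =
          0 := by
        simp only [sub_mul, Finset.sum_sub_distrib, ite_mul, one_mul, zero_mul,
          Finset.sum_ite_mem, Finset.univ_inter, this, sub_self]
      simp only [hψ]
      exact_mod_cast h2
    have hfr : f = ∑ a, ψ.repr ⟨f, hf⟩ a • (ψ a : B → ℚ) := by
      have := congrArg (fun v : V => (v : B → ℚ)) (ψ.sum_repr ⟨f, hf⟩)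
      simpa [-Basis.sum_repr] using this.symm
    rw [hfr]
    simp only [Finset.sum_apply, Pi.smul_apply, smul_eq_mul, Finset.mul_sum]
    rw [Finset.sum_comm]
    refine Finset.sum_eq_zero fun a _ => ?_
    have := congrArg (fun t => ψ.repr ⟨f, hf⟩ a * t) (hψ0 a)
    simp only [mul_zero, Finset.mul_sum] at this
    rw [← this]
    exact Finset.sum_congr rfl fun i _ => by ring

end Relations

/-! ### The real span -/

section RealSpan

variable {B : Type*} {V : Submodule ℚ (B → ℚ)}

/-- The space of real linear combinations of elements of `V`. -/
def realSpan (V : Submodule ℚ (B → ℚ)) : Submodule ℝ (B → ℝ) :=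
  Submodule.span ℝ {F | ∃ f ∈ V, F = fun b => (f b : ℝ)}

theorem comp_mem_realSpan {π : Equiv.Perm B} (hπ : IsSymmetry V π) {f : B → ℝ}
    (hf : f ∈ realSpan V) : f ∘ π ∈ realSpan V := by
  unfold realSpan at hf
  induction hf using Submodule.span_induction with
  | mem x hx =>
    obtain ⟨g, hg, rfl⟩ := hx
    exact Submodule.subset_span ⟨g ∘ π, hπ g hg, rfl⟩
  | zero => exact Submodule.zero_mem _
  | add x y _ _ hx hy => exact Submodule.add_mem _ hx hy
  | smul a x _ hx => exact Submodule.smul_mem _ a hx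

/-- A rational linear relation between evaluations on `V` also holds on the real span. -/
theorem sum_mul_eq_zero_of_mem_realSpan {ι : Type*} [Fintype ι] {k : ι → ℚ} {x : ι → B}
    (h : ∀ f ∈ V, ∑ i, k i * f (x i) = 0) {f : B → ℝ} (hf : f ∈ realSpan V) :
    ∑ i, (k i : ℝ) * f (x i) = 0 := by
  unfold realSpan at hf
  induction hf using Submodule.span_induction with
  | mem y hy =>
    obtain ⟨g, hg, rfl⟩ := hy
    have := congrArg (fun q : ℚ => (q : ℝ)) (h g hg)
    push_cast at this
    exact this
  | zero => simp
  | add y z _ _ hy hz => simp [mul_add, Finset.sum_add_distrib, hy, hz]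
  | smul a y _ hy =>
    have : ∀ i, (k i : ℝ) * (a • y) (x i) = a * ((k i : ℝ) * y (x i)) := fun i => by
      rw [Pi.smul_apply, smul_eq_mul]; ring
    simp only [this]
    rw [← Finset.mul_sum, hy, mul_zero]

variable {A : Type*} [Fintype A]

theorem mulVec_mem_realSpan (φ : Basis A ℚ V) (θ : A → ℝ) : basisMatrix φ *ᵥ θ ∈ realSpan V := by
  have : basisMatrix φ *ᵥ θ = ∑ a, θ a • fun b => (((φ a : B → ℚ) b : ℚ) : ℝ) := by
    ext b
    simp [Matrix.mulVec, dotProduct, basisMatrix, mul_comm]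
  rw [this]
  exact Submodule.sum_mem _ fun a _ => Submodule.smul_mem _ _
    (Submodule.subset_span ⟨φ a, (φ a).2, rfl⟩)

theorem exists_mulVec_eq (φ : Basis A ℚ V) {f : B → ℝ} (hf : f ∈ realSpan V) :
    ∃ θ, f = basisMatrix φ *ᵥ θ := by
  unfold realSpan at hf
  induction hf using Submodule.span_induction with
  | mem y hy =>
    obtain ⟨g, hg, rfl⟩ := hy
    refine ⟨fun a => φ.repr ⟨g, hg⟩ a, ?_⟩
    have := congrArg (fun v : V => (v : B → ℚ)) (φ.sum_repr ⟨g, hg⟩)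
    ext b
    have hb := congrArg (fun q : ℚ => (q : ℝ)) (congrFun this b)
    simp only [AddSubmonoidClass.coe_finsetSum, Finset.sum_apply, Submodule.coe_smul,
      Pi.smul_apply, smul_eq_mul] at hb
    push_cast at hb
    rw [← hb]
    simp [Matrix.mulVec, dotProduct, basisMatrix, mul_comm]
  | zero => exact ⟨0, by simp⟩
  | add y z _ _ hy hz =>
    obtain ⟨θ, rfl⟩ := hy
    obtain ⟨θ', rfl⟩ := hz
    exact ⟨θ + θ', (Matrix.mulVec_add _ _ _).symm⟩
  | smul a y _ hy =>
    obtain ⟨θ, rfl⟩ := hy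
    exact ⟨a • θ, (Matrix.mulVec_smul _ _ _).symm⟩

end RealSpan

/-! ### Spreading the distance to the integers -/

section Averaging

variable {B : Type*} [Fintype B] {V : Submodule ℚ (B → ℚ)}

/-- Resampling one coordinate of a uniformly random tuple leaves its distribution unchanged. -/
theorem sum_sum_update {ι : Type*} [Fintype ι] [DecidableEq ι] (F : (ι → B) → ℝ) (j : ι) :
    ∑ x : ι → B, ∑ z : B, F (Function.update x j z) = Fintype.card B * ∑ x, F x := by
  let e : (ι → B) × B ≃ (ι → B) × B :=
    { toFun := fun t => (Function.update t.1 j t.2, t.1 j)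
      invFun := fun t => (Function.update t.1 j t.2, t.1 j)
      left_inv := fun t => by simp
      right_inv := fun t => by simp }
  rw [← Fintype.sum_prod_type' (fun x z => F (Function.update x j z)),
    Fintype.sum_equiv e (fun t => F (Function.update t.1 j t.2)) (fun t => F t.1) (fun _ => rfl),
    Fintype.sum_prod_type, Finset.mul_sum]
  simp

/-- In a relation with coefficients in `{-1, 0, 1}`, the distance to the integers of a term that
occurs is at most the sum of the distances of the other terms. -/
theorem abs_sub_round_le_sum_erase {ι : Type*} [Fintype ι] [DecidableEq ι] {k : ι → ℤ}
    {y : ι → ℝ} (hk : ∀ i, |k i| ≤ 1) (hy : ∑ i, (k i : ℝ) * y i = 0) {i : ι} (hi : k i ≠ 0) :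
    |y i - round (y i)| ≤ ∑ j ∈ Finset.univ.erase i, |y j - round (y j)| := by
  have hki : k i * k i = 1 := by
    have h1 := abs_le.1 (hk i)
    have : k i = 1 ∨ k i = -1 := by omega
    rcases this with h | h <;> simp [h]
  have hki' : (k i : ℝ) * k i = 1 := by exact_mod_cast hki
  have hsum : (k i : ℝ) * y i + ∑ j ∈ Finset.univ.erase i, (k j : ℝ) * y j = 0 := by
    rw [Finset.add_sum_erase _ (fun j => (k j : ℝ) * y j) (Finset.mem_univ i), hy]
  have hyi : y i = -(k i * ∑ j ∈ Finset.univ.erase i, (k j : ℝ) * y j) := by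
    have : y i = k i * (k i * y i) := by rw [← mul_assoc, hki', one_mul]
    rw [this, eq_neg_of_add_eq_zero_left hsum, mul_neg]
  refine (round_le (y i) (-(k i * ∑ j ∈ Finset.univ.erase i, k j * round (y j)))).trans ?_
  have e : y i - ((-(k i * ∑ j ∈ Finset.univ.erase i, k j * round (y j)) : ℤ) : ℝ) =
      -(k i * ∑ j ∈ Finset.univ.erase i, (k j : ℝ) * (y j - round (y j))) := by
    conv_lhs => rw [hyi]
    push_cast
    simp only [mul_sub, Finset.sum_sub_distrib]
    ring
  have habs : ∀ j, |(k j : ℝ)| ≤ 1 := fun j => by exact_mod_cast hk j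
  rw [e, abs_neg, abs_mul]
  refine (mul_le_of_le_one_left (abs_nonneg _) (habs i)).trans
    ((Finset.abs_sum_le_sum_abs _ _).trans (Finset.sum_le_sum fun j _ => ?_))
  rw [abs_mul]
  exact mul_le_of_le_one_left (abs_nonneg _) (habs j)

/-- If a function in the real span of `V` is far from an integer at one point, then it is far from
the integers on average: every tuple of `s` points supports a relation, a symmetry moves a point
of its support to `b₀`, and under a uniformly random tuple the images of the other points are
uniformly distributed. -/
theorem card_mul_abs_sub_round_le {n c s : ℕ} (h : HasBoundedIntegerBasis lInftyNorm c V)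
    (φ : Basis (Fin n) ℚ V) (hs : (2 * (s * c) + 1) ^ n < 2 ^ s)
    (hsym : ∀ b₁ b₂ : B, ∃ π : Equiv.Perm B, IsSymmetry V π ∧ π b₁ = b₂)
    {f : B → ℝ} (hf : f ∈ realSpan V) (b₀ : B) :
    Fintype.card B * |f b₀ - round (f b₀)| ≤ s ^ 2 * ∑ b, |f b - round (f b)| := by
  classical
  set D : B → ℝ := fun b => |f b - round (f b)| with hD
  have hD0 : ∀ b, 0 ≤ D b := fun b => abs_nonneg _
  choose π hπ hπb using fun b => hsym b b₀
  have hrel : ∀ x : Fin s → B, D b₀ ≤ ∑ i, ∑ j ∈ Finset.univ.erase i, D (π (x i) (x j)) := by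
    intro x
    obtain ⟨k, hk0, hk1, hk⟩ := exists_sign_relation h φ hs x
    obtain ⟨i, hi⟩ := Function.ne_iff.1 hk0
    have h1 := sum_mul_eq_zero_of_mem_realSpan hk (comp_mem_realSpan (hπ (x i)) hf)
    simp only [Rat.cast_intCast] at h1
    have h2 := abs_sub_round_le_sum_erase hk1 h1 hi
    simp only [Function.comp_apply, hπb] at h2
    exact h2.trans (Finset.single_le_sum
      (f := fun i => ∑ j ∈ Finset.univ.erase i, D (π (x i) (x j)))
      (fun i _ => Finset.sum_nonneg fun j _ => hD0 _) (Finset.mem_univ i))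
  have hpair : ∀ i j : Fin s, j ≠ i → Fintype.card B * ∑ x : Fin s → B, D (π (x i) (x j)) =
      (Fintype.card B : ℝ) ^ s * ∑ b, D b := by
    intro i j hij
    rw [← sum_sum_update (fun x : Fin s → B => D (π (x i) (x j))) j]
    simp only [Function.update_self, Function.update_of_ne hij.symm]
    have : ∀ x : Fin s → B, ∑ z, D (π (x i) z) = ∑ b, D b := fun x =>
      Equiv.sum_comp (π (x i)) D
    simp [this]
  have hN : 0 < (Fintype.card B : ℝ) := by
    have : Nonempty B := ⟨b₀⟩
    exact_mod_cast Fintype.card_pos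
  have htot : (Fintype.card B : ℝ) ^ s * (Fintype.card B * D b₀) ≤
      (Fintype.card B : ℝ) ^ s * (s ^ 2 * ∑ b, D b) := by
    calc (Fintype.card B : ℝ) ^ s * (Fintype.card B * D b₀)
        = Fintype.card B * ∑ x : Fin s → B, D b₀ := by simp; ring
      _ ≤ Fintype.card B *
          ∑ x : Fin s → B, ∑ i, ∑ j ∈ Finset.univ.erase i, D (π (x i) (x j)) := by
          gcongr with x
          exact hrel x
      _ = ∑ i, ∑ j ∈ Finset.univ.erase i,
          Fintype.card B * ∑ x : Fin s → B, D (π (x i) (x j)) := by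
          rw [Finset.sum_comm, Finset.mul_sum]
          refine Finset.sum_congr rfl fun i _ => ?_
          rw [Finset.sum_comm, Finset.mul_sum]
      _ = ∑ i : Fin s, ∑ j ∈ Finset.univ.erase i, (Fintype.card B : ℝ) ^ s * ∑ b, D b :=
          Finset.sum_congr rfl fun i _ => Finset.sum_congr rfl fun j hj =>
            hpair i j (Finset.ne_of_mem_erase hj)
      _ ≤ ∑ i : Fin s, ∑ j : Fin s, (Fintype.card B : ℝ) ^ s * ∑ b, D b := by
          refine Finset.sum_le_sum fun i _ =>
            Finset.sum_le_sum_of_subset_of_nonneg (Finset.erase_subset _ _) fun _ _ _ => ?_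
          exact mul_nonneg (by positivity) (Finset.sum_nonneg fun b _ => hD0 b)
      _ = (Fintype.card B : ℝ) ^ s * (s ^ 2 * ∑ b, D b) := by simp; ring
  exact le_of_mul_le_mul_left htot (by positivity)

theorem norm_prod_bernoulliChar_le {n c s : ℕ} (h : HasBoundedIntegerBasis lInftyNorm c V)
    (φ : Basis (Fin n) ℚ V) (hs : (2 * (s * c) + 1) ^ n < 2 ^ s)
    (hsym : ∀ b₁ b₂ : B, ∃ π : Equiv.Perm B, IsSymmetry V π ∧ π b₁ = b₂)
    {f : B → ℝ} (hf : f ∈ realSpan V) {p ε : ℝ} (hp₀ : 0 ≤ p) (hp₁ : p ≤ 1) (hε : 0 ≤ ε)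
    {b₀ : B} (hb₀ : ε ≤ |f b₀ - round (f b₀)|) :
    ‖∏ b, bernoulliChar p (f b)‖ ≤
      Real.exp (-(8 * (p * (1 - p) * Fintype.card B) * ε ^ 2 / s ^ 4)) := by
  set D : B → ℝ := fun b => |f b - round (f b)| with hD
  set N : ℝ := (Fintype.card B : ℝ) with hNdef
  have hq : 0 ≤ p * (1 - p) := mul_nonneg hp₀ (by linarith)
  have hN : 0 < N := by
    have : Nonempty B := ⟨b₀⟩
    exact Nat.cast_pos.2 Fintype.card_pos
  have hs0 : 0 < (s : ℝ) := by
    rcases Nat.eq_zero_or_pos s with h0 | h0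
    · subst h0
      simp at hs
    · exact_mod_cast h0
  have h1 : N * ε ≤ s ^ 2 * ∑ b, D b :=
    (mul_le_mul_of_nonneg_left hb₀ hN.le).trans (card_mul_abs_sub_round_le h φ hs hsym hf b₀)
  have h2 : (∑ b, D b) ^ 2 ≤ N * ∑ b, D b ^ 2 := sq_sum_le_card_mul_sum_sq
  have h3 : N * ε ^ 2 ≤ s ^ 4 * ∑ b, D b ^ 2 := by
    have : N * (N * ε ^ 2) ≤ N * (s ^ 4 * ∑ b, D b ^ 2) := by
      calc N * (N * ε ^ 2) = (N * ε) ^ 2 := by ring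
        _ ≤ (s ^ 2 * ∑ b, D b) ^ 2 := pow_le_pow_left₀ (by positivity) h1 2
        _ = s ^ 4 * (∑ b, D b) ^ 2 := by ring
        _ ≤ s ^ 4 * (N * ∑ b, D b ^ 2) := by gcongr
        _ = N * (s ^ 4 * ∑ b, D b ^ 2) := by ring
    exact le_of_mul_le_mul_left this hN
  rw [norm_prod]
  calc ∏ b, ‖bernoulliChar p (f b)‖
      ≤ ∏ b, Real.exp (-(8 * (p * (1 - p)) * D b ^ 2)) :=
        Finset.prod_le_prod (fun _ _ => norm_nonneg _)
          fun b _ => norm_bernoulliChar_le_round hp₀ hp₁ (f b)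
    _ = Real.exp (-(8 * (p * (1 - p)) * ∑ b, D b ^ 2)) := by
        rw [← Real.exp_sum, Finset.sum_neg_distrib, Finset.mul_sum]
    _ ≤ _ := by
        rw [Real.exp_le_exp, neg_le_neg_iff, div_le_iff₀ (by positivity)]
        nlinarith [mul_le_mul_of_nonneg_left h3 hq]

end Averaging

/-! ### The Parseval frame of a symmetric space -/

section Frame

open scoped RealInnerProductSpace

theorem norm_sq_eq_of_transitive {B E : Type*} [Fintype B] [NormedAddCommGroup E]
    [InnerProductSpace ℝ E] [FiniteDimensional ℝ E] {u : B → E}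
    (hu : ∀ y, ∑ b, ⟪u b, y⟫ ^ 2 = ‖y‖ ^ 2)
    (hsym : ∀ b₁ b₂ : B, ∃ π : Equiv.Perm B, π b₁ = b₂ ∧ ∀ y, ∃ z, ∀ b, ⟪u (π b), y⟫ = ⟪u b, z⟫)
    (b : B) : ‖u b‖ ^ 2 = finrank ℝ E / Fintype.card B := by
  -- the reproducing kernel at `b₂`, moved to `b₁` by a symmetry, shows `‖u b₂‖ ≤ ‖u b₁‖`
  have hle : ∀ b₁ b₂, ‖u b₂‖ ≤ ‖u b₁‖ := by
    intro b₁ b₂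
    obtain ⟨π, hπ, hz⟩ := hsym b₁ b₂
    obtain ⟨z, hz⟩ := hz (u b₂)
    have h1 : ‖z‖ ^ 2 = ‖u b₂‖ ^ 2 := by
      rw [← hu z, ← hu (u b₂), ← Equiv.sum_comp π fun b => ⟪u b, u b₂⟫ ^ 2]
      exact Finset.sum_congr rfl fun b _ => by rw [hz]
    have h1' : ‖z‖ = ‖u b₂‖ := (sq_eq_sq₀ (norm_nonneg _) (norm_nonneg _)).1 h1
    have h2 : ‖u b₂‖ * ‖u b₂‖ ≤ ‖u b₁‖ * ‖u b₂‖ := by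
      rw [← real_inner_self_eq_norm_mul_norm]
      conv_lhs => rw [← hπ]
      rw [hπ]
      have h3 := hz b₁
      rw [hπ] at h3
      rw [h3]
      exact (real_inner_le_norm _ _).trans_eq (by rw [h1'])
    rcases (norm_nonneg (u b₂)).eq_or_lt with h0 | h0
    · rw [← h0]; exact norm_nonneg _
    · exact le_of_mul_le_mul_right h2 h0
  have htot : ∑ b, ‖u b‖ ^ 2 = finrank ℝ E := by
    let e := stdOrthonormalBasis ℝ E
    have h1 : ∀ b, ‖u b‖ ^ 2 = ∑ i, ⟪u b, e i⟫ ^ 2 := fun b => by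
      rw [← e.sum_sq_norm_inner_right]
      simp [real_inner_comm]
    simp only [h1]
    rw [Finset.sum_comm]
    simp [hu]
  have hN : (Fintype.card B : ℝ) ≠ 0 := by
    have : Nonempty B := ⟨b⟩
    exact_mod_cast Fintype.card_ne_zero
  rw [eq_div_iff hN, ← htot]
  have : ∀ b', ‖u b'‖ = ‖u b‖ := fun b' => le_antisymm (hle _ _) (hle _ _)
  simp [this, mul_comm]

variable {B : Type*} [Fintype B] {V : Submodule ℚ (B → ℚ)} {n : ℕ}

open scoped MatrixOrder Matrix.Norms.L2Operator in
/-- A change of coordinates that orthonormalizes the columns of the matrix of a basis. -/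
theorem exists_orthonormalizing (φ : Basis (Fin n) ℚ V) :
    ∃ T : Matrix (Fin n) (Fin n) ℝ, (basisMatrix φ * T)ᵀ * (basisMatrix φ * T) = 1 ∧
      T * Tᵀ = ((basisMatrix φ)ᵀ * basisMatrix φ)⁻¹ ∧
      |T.det| = 1 / √(((basisMatrix φ)ᵀ * basisMatrix φ).det) := by
  set M := basisMatrix φ
  have hps : (Mᵀ * M).PosSemidef := by
    have := Matrix.posSemidef_conjTranspose_mul_self M
    simpa using this
  obtain ⟨S, hS⟩ : ∃ S : Matrix (Fin n) (Fin n) ℝ, Mᵀ * M = Sᵀ * S := by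
    obtain ⟨S, hS⟩ := CStarAlgebra.nonneg_iff_eq_star_mul_self.mp hps.nonneg
    rw [Matrix.star_eq_conjTranspose, Matrix.conjTranspose_eq_transpose_of_trivial] at hS
    exact ⟨S, hS⟩
  have hu := isUnit_det_gram φ
  change IsUnit (Mᵀ * M).det at hu
  have hdet : (Mᵀ * M).det = S.det ^ 2 := by rw [hS, Matrix.det_mul, Matrix.det_transpose, sq]
  have hSdet : S.det ≠ 0 := fun h0 => by
    rw [hdet, h0] at hu
    simp at hu
  have hSu : IsUnit S.det := isUnit_iff_ne_zero.2 hSdet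
  have h1 : S * S⁻¹ = 1 := Matrix.mul_nonsing_inv _ hSu
  have h2 : (S⁻¹)ᵀ * Sᵀ = 1 := by rw [← Matrix.transpose_mul, h1, Matrix.transpose_one]
  refine ⟨S⁻¹, ?_, ?_, ?_⟩
  · calc (M * S⁻¹)ᵀ * (M * S⁻¹) = (S⁻¹)ᵀ * (Mᵀ * M) * S⁻¹ := by
          rw [Matrix.transpose_mul]; simp only [Matrix.mul_assoc]
      _ = ((S⁻¹)ᵀ * Sᵀ) * (S * S⁻¹) := by rw [hS]; simp only [Matrix.mul_assoc]
      _ = 1 := by rw [h1, h2, Matrix.one_mul]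
  · rw [hS, Matrix.mul_inv_rev, Matrix.transpose_nonsing_inv]
  · rw [hdet, Real.sqrt_sq_eq_abs, Matrix.det_nonsing_inv, Ring.inverse_eq_inv', abs_inv, one_div]

/-- The vectors representing the evaluations at the points of `B` in orthonormal coordinates. -/
def frameVector (φ : Basis (Fin n) ℚ V) (T : Matrix (Fin n) (Fin n) ℝ) (b : B) :
    EuclideanSpace ℝ (Fin n) :=
  WithLp.toLp 2 ((basisMatrix φ * T) b)

omit [Fintype B] in
theorem inner_frameVector (φ : Basis (Fin n) ℚ V) (T : Matrix (Fin n) (Fin n) ℝ) (b : B)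
    (y : EuclideanSpace ℝ (Fin n)) :
    ⟪frameVector φ T b, y⟫ = (basisMatrix φ *ᵥ (T *ᵥ y.ofLp)) b := by
  rw [Matrix.mulVec_mulVec]
  simp [frameVector, Matrix.mulVec, dotProduct, PiLp.inner_apply, mul_comm]

theorem sum_inner_frameVector_sq (φ : Basis (Fin n) ℚ V) {T : Matrix (Fin n) (Fin n) ℝ}
    (hT : (basisMatrix φ * T)ᵀ * (basisMatrix φ * T) = 1) (y : EuclideanSpace ℝ (Fin n)) :
    ∑ b, ⟪frameVector φ T b, y⟫ ^ 2 = ‖y‖ ^ 2 := by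
  simp only [inner_frameVector, Matrix.mulVec_mulVec]
  set U := basisMatrix φ * T
  have : ∑ b, (U *ᵥ y.ofLp) b ^ 2 = (U *ᵥ y.ofLp) ⬝ᵥ (U *ᵥ y.ofLp) := by
    simp [dotProduct, sq]
  rw [this, Matrix.dotProduct_mulVec, Matrix.vecMul_mulVec, ← Matrix.mulVec_transpose,
    Matrix.transpose_mul, Matrix.transpose_transpose, hT, Matrix.one_mulVec,
    EuclideanSpace.real_norm_sq_eq]
  simp [dotProduct, sq]

theorem norm_frameVector_sq (φ : Basis (Fin n) ℚ V) {T : Matrix (Fin n) (Fin n) ℝ}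
    (hT : (basisMatrix φ * T)ᵀ * (basisMatrix φ * T) = 1) (hTdet : IsUnit T.det)
    (hsym : ∀ b₁ b₂ : B, ∃ π : Equiv.Perm B, IsSymmetry V π ∧ π b₁ = b₂) (b : B) :
    ‖frameVector φ T b‖ ^ 2 = n / Fintype.card B := by
  have h := norm_sq_eq_of_transitive (sum_inner_frameVector_sq φ hT) (fun b₁ b₂ => by
    obtain ⟨π, hπ, hb⟩ := hsym b₁ b₂
    refine ⟨π, hb, fun y => ?_⟩
    obtain ⟨θ, hθ⟩ := exists_mulVec_eq φ
      (comp_mem_realSpan hπ (mulVec_mem_realSpan φ (T *ᵥ y.ofLp)))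
    refine ⟨WithLp.toLp 2 (T⁻¹ *ᵥ θ), fun b => ?_⟩
    rw [inner_frameVector, inner_frameVector, Matrix.mulVec_mulVec θ,
      Matrix.mul_nonsing_inv _ hTdet, Matrix.one_mulVec, ← hθ]
    rfl) b
  rw [h, finrank_euclideanSpace_fin]

theorem norm_sum_smul_frameVector_sq (φ : Basis (Fin n) ℚ V) {T : Matrix (Fin n) (Fin n) ℝ}
    (hT : T * Tᵀ = ((basisMatrix φ)ᵀ * basisMatrix φ)⁻¹) (γ : B → ℝ) :
    ‖∑ b, γ b • frameVector φ T b‖ ^ 2 = normV V γ ^ 2 := by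
  set M := basisMatrix φ
  have h1 : ‖∑ b, γ b • frameVector φ T b‖ ^ 2 = formV V γ γ := by
    have e : (∑ b, γ b • frameVector φ T b : EuclideanSpace ℝ (Fin n)).ofLp = γ ᵥ* (M * T) := by
      ext a
      simp [frameVector, Matrix.vecMul, dotProduct, M]
    rw [EuclideanSpace.real_norm_sq_eq, formV_eq φ, ← hT]
    have e2 : M * (T * Tᵀ) * Mᵀ = (M * T) * (M * T)ᵀ := by
      rw [Matrix.transpose_mul]; simp only [Matrix.mul_assoc]
    rw [e2, ← Matrix.mulVec_mulVec, Matrix.dotProduct_mulVec, Matrix.mulVec_transpose]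
    simp only [e, dotProduct, sq]
  rw [normV, Real.sq_sqrt (by rw [← h1]; positivity), h1]

end Frame

/-! ### Fourier inversion -/

section Fourier

open MeasureTheory

theorem setIntegral_exp_int_mul (m : ℤ) :
    ∫ x in Set.Ico (0 : ℝ) 1, Complex.exp (2 * Real.pi * (m * x) * Complex.I) =
      if m = 0 then 1 else 0 := by
  rw [integral_Ico_eq_integral_Ioc, ← intervalIntegral.integral_of_le zero_le_one]
  split_ifs with hm
  · simp [hm]
  · have hc : (2 * Real.pi * m * Complex.I : ℂ) ≠ 0 := by
      simp [hm, Real.pi_ne_zero]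
    have e : ∀ x : ℝ, Complex.exp (2 * Real.pi * (m * x) * Complex.I) =
        Complex.exp (2 * Real.pi * m * Complex.I * x) := fun x => by
      congr 1; ring
    simp only [e]
    rw [integral_exp_mul_complex hc]
    have h1 : Complex.exp (2 * Real.pi * m * Complex.I * ((1 : ℝ) : ℂ)) = 1 := by
      rw [Complex.exp_eq_one_iff]
      exact ⟨m, by push_cast; ring⟩
    rw [h1]
    simp

variable {n : ℕ}

theorem setIntegral_cube_exp_sum (m : Fin n → ℤ) :
    ∫ θ in Set.pi Set.univ fun _ : Fin n => Set.Ico (0 : ℝ) 1,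
        Complex.exp (2 * Real.pi * (∑ a, (m a : ℂ) * θ a) * Complex.I) =
      if m = 0 then 1 else 0 := by
  have e : ∀ θ : Fin n → ℝ, Complex.exp (2 * Real.pi * (∑ a, (m a : ℂ) * θ a) * Complex.I) =
      ∏ a, Complex.exp (2 * Real.pi * (m a * θ a) * Complex.I) := fun θ => by
    rw [← Complex.exp_sum, Finset.mul_sum, Finset.sum_mul]
  simp only [e]
  rw [volume_pi, Measure.restrict_pi_pi]
  rw [integral_fintype_prod_eq_prod
    (f := fun a (x : ℝ) => Complex.exp (2 * Real.pi * (m a * x) * Complex.I))]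
  simp only [setIntegral_exp_int_mul]
  split_ifs with hm
  · simp [hm]
  · obtain ⟨a, ha⟩ := Function.ne_iff.1 hm
    exact Finset.prod_eq_zero (Finset.mem_univ a) (if_neg ha)

variable {B : Type*} [Fintype B]

/-- The integrand of the Fourier inversion formula, as a function of the values `x b` of a linear
combination of the integer basis. -/
def fourierIntegrand (p : ℝ) (γ : B → ℤ) (x : B → ℝ) : ℂ :=
  (∏ b, bernoulliChar p (x b)) *
    Complex.exp (-(2 * Real.pi * ∑ b, ((γ b : ℝ) : ℂ) * x b) * Complex.I)

theorem continuous_fourierIntegrand (p : ℝ) (γ : B → ℤ) : Continuous (fourierIntegrand p γ) := by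
  have := continuous_bernoulliChar p
  unfold fourierIntegrand
  fun_prop

theorem norm_fourierIntegrand (p : ℝ) (γ : B → ℤ) (x : B → ℝ) :
    ‖fourierIntegrand p γ x‖ = ‖∏ b, bernoulliChar p (x b)‖ := by
  have h : (-(2 * Real.pi * ∑ b, ((γ b : ℝ) : ℂ) * x b) * Complex.I : ℂ) =
      ((-(2 * Real.pi * ∑ b, (γ b : ℝ) * x b) : ℝ) : ℂ) * Complex.I := by push_cast; ring
  rw [fourierIntegrand, norm_mul, h, Complex.norm_exp_ofReal_mul_I, mul_one]

theorem fourierIntegrand_add_intCast (p : ℝ) (γ : B → ℤ) (x : B → ℝ) (k : B → ℤ) :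
    fourierIntegrand p γ (fun b => x b + k b) = fourierIntegrand p γ x := by
  simp only [fourierIntegrand, bernoulliChar_add_intCast]
  congr 1
  rw [Complex.exp_eq_exp_iff_exists_int]
  refine ⟨-∑ b, γ b * k b, ?_⟩
  push_cast
  simp only [mul_add, Finset.sum_add_distrib]
  ring

open Classical in
theorem fourierIntegrand_eq_sum (p : ℝ) (γ : B → ℤ) (Φ : B → Fin n → ℤ) (θ : Fin n → ℝ) :
    fourierIntegrand p γ (fun b => ∑ a, (Φ b a : ℝ) * θ a) =
      ∑ S : Finset B, ((p ^ S.card * (1 - p) ^ (Sᶜ).card : ℝ) : ℂ) *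
        Complex.exp (2 * Real.pi *
          (∑ a, ((∑ b ∈ S, Φ b a - ∑ b, γ b * Φ b a : ℤ) : ℂ) * θ a) * Complex.I) := by
  simp only [fourierIntegrand, bernoulliChar]
  have hadd : ∏ b, ((1 - p : ℂ) + p * Complex.exp (2 * Real.pi *
      ((∑ a, (Φ b a : ℝ) * θ a : ℝ) : ℂ) * Complex.I)) =
      ∑ S : Finset B, (∏ b ∈ S, p * Complex.exp (2 * Real.pi *
      ((∑ a, (Φ b a : ℝ) * θ a : ℝ) : ℂ) * Complex.I)) * ∏ b ∈ Sᶜ, (1 - p : ℂ) := by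
    simp only [add_comm (1 - p : ℂ)]
    rw [Finset.prod_add, Finset.powerset_univ]
    rfl
  rw [hadd, Finset.sum_mul]
  refine Finset.sum_congr rfl fun S _ => ?_
  rw [Finset.prod_mul_distrib, Finset.prod_const, Finset.prod_const, ← Complex.exp_sum]
  have e : ∀ x y z w : ℂ, x * y * z * w = x * z * (y * w) := fun x y z w => by ring
  rw [e, ← Complex.exp_add]
  push_cast
  congr 2
  rw [← Finset.sum_mul, ← add_mul]
  congr 1
  rw [← Finset.mul_sum, ← sub_eq_add_neg, ← mul_sub]
  congr 1
  simp only [sub_mul, Finset.sum_sub_distrib, Finset.sum_mul, Finset.mul_sum]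
  rw [Finset.sum_comm (s := S), Finset.sum_comm (s := (Finset.univ : Finset B))]
  simp only [mul_assoc]

/-- The probability that the random sum `∑_{b ∈ T} Φ b` takes a given value. -/
theorem setBernoulli_real_eq_integral (p : ℝ) (hp₀ : 0 ≤ p) (hp₁ : p ≤ 1) (γ : B → ℤ)
    (Φ : B → Fin n → ℤ) {E : Set (Set B)} (hE : ∀ S : Finset B, (S : Set B) ∈ E ↔
      ∀ a, ∑ b ∈ S, Φ b a = ∑ b, γ b * Φ b a) :
    (((setBernoulli (Set.univ : Set B) ⟨p, hp₀, hp₁⟩).real E : ℝ) : ℂ) =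
      ∫ θ in Set.pi Set.univ fun _ : Fin n => Set.Ico (0 : ℝ) 1,
        fourierIntegrand p γ (fun b => ∑ a, (Φ b a : ℝ) * θ a) := by
  classical
  simp only [fourierIntegrand_eq_sum]
  rw [integral_finsetSum]
  swap
  · intro S _
    have hc : IsCompact (Set.pi Set.univ fun _ : Fin n => Set.Icc (0 : ℝ) 1) :=
      isCompact_univ_pi fun _ => isCompact_Icc
    refine IntegrableOn.mono_set (ContinuousOn.integrableOn_compact hc ?_)
      (Set.pi_mono fun _ _ => Set.Ico_subset_Icc_self)
    exact Continuous.continuousOn (by fun_prop)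
  simp only [integral_const_mul, setIntegral_cube_exp_sum]
  have h1 : E = ⋃ S ∈ (Finset.univ.filter fun S : Finset B => (S : Set B) ∈ E), {(S : Set B)} := by
    ext T
    simp only [Finset.mem_filter, Finset.mem_univ, true_and, Set.mem_iUnion, Set.mem_singleton_iff,
      exists_prop]
    constructor
    · intro hT
      exact ⟨T.toFinite.toFinset, by simpa using hT, by simp⟩
    · rintro ⟨S, hS, rfl⟩
      exact hS
  have h2 : (setBernoulli (Set.univ : Set B) ⟨p, hp₀, hp₁⟩).real E =
      ∑ S : Finset B, (if (S : Set B) ∈ E then p ^ S.card * (1 - p) ^ (Sᶜ).card else 0) := by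
    conv_lhs => rw [h1]
    rw [measureReal_biUnion_finset, Finset.sum_filter]
    · refine Finset.sum_congr rfl fun S _ => ?_
      split_ifs
      · rw [setBernoulli_real_singleton _ (Set.subset_univ _) Set.finite_univ,
          ← Set.compl_eq_univ_sdiff, Set.ncard_coe_finset, ← Finset.coe_compl, Set.ncard_coe_finset]
      · rfl
    · intro S _ S' _ hne
      simpa [Function.onFun] using hne
    · intro S _
      exact measurableSet_singleton _
  rw [h2]
  push_cast
  refine Finset.sum_congr rfl fun S _ => ?_
  have h3 : ((fun a => ∑ b ∈ S, Φ b a - ∑ b, γ b * Φ b a) = 0) ↔ (S : Set B) ∈ E := by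
    rw [hE, funext_iff]
    simp [sub_eq_zero]
  simp only [h3]
  split_ifs <;> simp

end Fourier

/-! ### Changing the fundamental domain -/

section FundamentalDomain

open MeasureTheory
open scoped Pointwise

variable {G α : Type*} [AddGroup G] [Countable G] [AddAction G α] [MeasurableSpace α]
  {μ : Measure α} [MeasurableConstVAdd G α] [VAddInvariantMeasure G α μ]

omit [VAddInvariantMeasure G α μ] in
/-- A set `Z` with pairwise disjoint translates extends to a fundamental domain by the part of a
given fundamental domain `F` that the translates of `Z` miss. -/
theorem isAddFundamentalDomain_union {F Z : Set α} (hF : IsAddFundamentalDomain G F μ)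
    (hFm : MeasurableSet F) (hZm : MeasurableSet Z)
    (hZ : ∀ g : G, ∀ x ∈ Z, g +ᵥ x ∈ Z → g = 0) :
    IsAddFundamentalDomain G (Z ∪ (F \ ⋃ g : G, g +ᵥ Z)) μ := by
  set O : Set α := ⋃ g : G, g +ᵥ Z with hO
  have hOm : MeasurableSet O := MeasurableSet.iUnion fun g => hZm.const_vadd g
  have hOinv : ∀ (g : G) (x : α), g +ᵥ x ∈ O ↔ x ∈ O := by
    have h1 : ∀ (g : G) (x : α), x ∈ O → g +ᵥ x ∈ O := by
      intro g x hx
      obtain ⟨k, z, hz, rfl⟩ := Set.mem_iUnion.1 hx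
      exact Set.mem_iUnion.2 ⟨g + k, z, hz, by simp [add_vadd]⟩
    refine fun g x => ⟨fun h => ?_, h1 g x⟩
    simpa using h1 (-g) _ h
  have hZO : Z ⊆ O := fun x hx => Set.mem_iUnion.2 ⟨0, x, hx, by simp⟩
  refine ⟨(hZm.union (hFm.diff hOm)).nullMeasurableSet, ?_, ?_⟩
  · filter_upwards [hF.ae_covers] with x hx
    by_cases hxO : x ∈ O
    · obtain ⟨k, z, hz, rfl⟩ := Set.mem_iUnion.1 hxO
      exact ⟨-k, Or.inl (by simpa using hz)⟩
    · obtain ⟨g, hg⟩ := hx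
      exact ⟨g, Or.inr ⟨hg, fun h => hxO ((hOinv g x).1 h)⟩⟩
  · intro g k hgk
    refine measure_mono_null ?_ (hF.aedisjoint hgk)
    rintro _ ⟨⟨x, hx, rfl⟩, ⟨y, hy, hxy⟩⟩
    simp only at hxy
    have hyx : y = (-k + g) +ᵥ x := by rw [add_vadd, ← hxy]; simp
    rcases hx with hx | hx
    · rcases hy with hy | hy
      · rw [hyx] at hy
        have := hZ _ x hx hy
        exact absurd (neg_add_eq_zero.1 this).symm hgk
      · refine absurd ?_ hy.2
        rw [hyx]
        exact (hOinv _ _).2 (hZO hx)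
    · rcases hy with hy | hy
      · refine absurd ?_ hx.2
        have h4 := hZO hy
        rw [hyx] at h4
        exact (hOinv _ _).1 h4
      · exact ⟨⟨x, hx.1, rfl⟩, ⟨y, hy.1, hxy⟩⟩

/-- The integral of a periodic function over a fundamental domain is the integral over a set `Z`
with pairwise disjoint translates, up to the supremum of the function off these translates. -/
theorem norm_setIntegral_sub_setIntegral_le {F Z : Set α} (hF : IsAddFundamentalDomain G F μ)
    (hFm : MeasurableSet F) (hF1 : μ F ≤ 1) (hZm : MeasurableSet Z)
    (hZ : ∀ g : G, ∀ x ∈ Z, g +ᵥ x ∈ Z → g = 0) {h : α → ℂ} (hinv : ∀ (g : G) x, h (g +ᵥ x) = h x)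
    (hint : IntegrableOn h F μ) {r : ℝ} (hr : 0 ≤ r)
    (hle : ∀ x, (∀ g : G, g +ᵥ x ∉ Z) → ‖h x‖ ≤ r) :
    ‖∫ x in F, h x ∂μ - ∫ x in Z, h x ∂μ‖ ≤ r := by
  have hD := isAddFundamentalDomain_union hF hFm hZm hZ
  set O : Set α := ⋃ g : G, g +ᵥ Z with hO
  have hOm : MeasurableSet O := MeasurableSet.iUnion fun g => hZm.const_vadd g
  have hZO : Z ⊆ O := fun x hx => Set.mem_iUnion.2 ⟨0, x, hx, by simp⟩
  have hintD : IntegrableOn h (Z ∪ (F \ O)) μ := (hD.integrableOn_iff hF hinv).2 hint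
  rw [hF.setIntegral_eq hD hinv, setIntegral_union (Set.disjoint_left.2 fun x hx hx' =>
    hx'.2 (hZO hx)) (hFm.diff hOm) (hintD.mono_set Set.subset_union_left)
    (hintD.mono_set Set.subset_union_right), add_sub_cancel_left]
  have hfin : μ (F \ O) ≤ 1 := (measure_mono Set.sdiff_subset).trans hF1
  refine (norm_setIntegral_le_of_norm_le_const (hfin.trans_lt ENNReal.one_lt_top)
    (C := r) fun x hx => hle x fun g hg => hx.2 ?_).trans ?_
  · exact Set.mem_iUnion.2 ⟨-g, g +ᵥ x, hg, by simp⟩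
  · have : μ.real (F \ O) ≤ 1 := by
      rw [measureReal_def]
      exact ENNReal.toReal_le_of_le_ofReal zero_le_one (by simpa using hfin)
    nlinarith

end FundamentalDomain

/-! ### Orthonormal coordinates -/

section Coordinates

open MeasureTheory

theorem setIntegral_mulVec {n : ℕ} (T : Matrix (Fin n) (Fin n) ℝ) (hT : T.det ≠ 0)
    (Z : Set (Fin n → ℝ)) (hZ : MeasurableSet Z) (h : (Fin n → ℝ) → ℂ) (hh : Continuous h) :
    ∫ θ in Z, h θ =
      |T.det| • ∫ y in {y : EuclideanSpace ℝ (Fin n) | T *ᵥ y.ofLp ∈ Z}, h (T *ᵥ y.ofLp) := by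
  have hcont : Continuous fun y : Fin n → ℝ => T *ᵥ y := by fun_prop
  have h1 : (volume : Measure (Fin n → ℝ)) =
      ENNReal.ofReal |T.det| • Measure.map (fun y => T *ᵥ y) volume := by
    have := Real.map_matrix_volume_pi_eq_smul_volume_pi hT
    have h2 : Measure.map (fun y => T *ᵥ y) volume =
      ENNReal.ofReal |T.det⁻¹| • (volume : Measure (Fin n → ℝ)) := this
    rw [h2, smul_smul, ← ENNReal.ofReal_mul (abs_nonneg _), abs_inv,
      mul_inv_cancel₀ (abs_ne_zero.2 hT), ENNReal.ofReal_one, one_smul]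
  conv_lhs => rw [h1]
  rw [Measure.restrict_smul, integral_smul_measure, ENNReal.toReal_ofReal (abs_nonneg _),
    setIntegral_map hZ hh.aestronglyMeasurable hcont.aemeasurable,
    ← (PiLp.volume_preserving_ofLp (Fin n)).setIntegral_preimage_emb
      (MeasurableEquiv.toLp 2 (Fin n → ℝ)).symm.measurableEmbedding]
  rfl

end Coordinates

/-! ### Numerical estimates -/

section Numerics

/-- Tuples of length of order `n log (2 c n)` suffice for the pigeonhole principle. -/
theorem exists_tuple_length {n c : ℕ} (hn : 1 ≤ n) (hc : 1 ≤ c) :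
    ∃ s : ℕ, (2 * (s * c) + 1) ^ n < 2 ^ s ∧ (s : ℝ) ≤ 34 * (n * Real.log (2 * c * n)) ∧
      n ≤ s := by
  set ℓ := Real.log (2 * c * n) with hℓ
  have hn1 : (1 : ℝ) ≤ n := by exact_mod_cast hn
  have hc1 : (1 : ℝ) ≤ c := by exact_mod_cast hc
  have hcn : (1 : ℝ) ≤ c * n := one_le_mul_of_one_le_of_one_le hc1 hn1
  have hlog2 : 0.69 < Real.log 2 := lt_trans (by norm_num) Real.log_two_gt_d9
  have hℓ2 : Real.log 2 ≤ ℓ := Real.log_le_log (by norm_num) (by nlinarith)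
  have hℓ0 : 0 < ℓ := by linarith
  have hnℓ : 0.69 ≤ n * ℓ := by nlinarith
  set s := ⌈32 * (n * ℓ)⌉₊ with hs
  have hs1 : 32 * (n * ℓ) ≤ s := Nat.le_ceil _
  have hs2 : (s : ℝ) ≤ 34 * (n * ℓ) := by
    have := (Nat.ceil_lt_add_one (show 0 ≤ 32 * (n * ℓ) by positivity)).le
    linarith
  refine ⟨s, ?_, hs2, ?_⟩
  · have hspos : (1 : ℝ) ≤ s := by linarith
    have hreal : ((2 * (s * c) + 1 : ℝ)) ^ n < 2 ^ s := by
      rw [← Real.log_lt_log_iff (by positivity) (by positivity), Real.log_pow, Real.log_pow]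
      have h1 : Real.log (2 * (s * c) + 1) ≤ 9 * ℓ := by
        have h2 : (2 * (s * c) + 1 : ℝ) ≤ 128 * ((2 * c * n) * ℓ) := by
          have : (1 : ℝ) ≤ s * c := one_le_mul_of_one_le_of_one_le hspos hc1
          have h3 : (s : ℝ) * c ≤ 34 * (n * ℓ) * c := by gcongr
          have h4 : 0 ≤ c * (n * ℓ) := by positivity
          nlinarith
        have h128 : Real.log 128 = 7 * Real.log 2 := by
          rw [show (128 : ℝ) = 2 ^ 7 by norm_num, Real.log_pow]; norm_num
        calc Real.log (2 * (s * c) + 1) ≤ Real.log (128 * ((2 * c * n) * ℓ)) :=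
              Real.log_le_log (by positivity) h2
          _ = 7 * Real.log 2 + (ℓ + Real.log ℓ) := by
              rw [Real.log_mul (by norm_num) (by positivity), h128,
                Real.log_mul (by positivity) hℓ0.ne']
          _ ≤ 9 * ℓ := by linarith [Real.log_le_self hℓ0.le]
      have h5 : (n : ℝ) * Real.log (2 * (s * c) + 1) ≤ n * (9 * ℓ) := by gcongr
      have h6 : 32 * (n * ℓ) * 0.69 ≤ s * Real.log 2 := by gcongr
      nlinarith
    exact_mod_cast hreal
  · have : (n : ℝ) ≤ s := by nlinarith
    exact_mod_cast this

set_option maxHeartbeats 1000000 in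
/-- The logarithms lost in the estimate of the Fourier transform away from the lattice are
absorbed by one factor `c₂` and the powers of `log (2 c₃ n)` in the lower bound for `M`. The
constant `10690688 = 8 · 34⁴` comes from the bound `s ≤ 34 n log (2 c₂ n)` on the length of tuples. -/
theorem mul_log_le_of_le {n c₂ c₃ M : ℝ} (hn : 1 ≤ n) (hc₂ : 1 ≤ c₂) (hc₃ : 1 ≤ c₃)
    (hM : 10 ^ 27 * (c₂ * c₃ ^ 2 * n ^ 6 * Real.log (2 * c₃ * n) ^ 6) ≤ M) :
    10690688 * (c₃ ^ 2 * n ^ 6 * Real.log (2 * c₂ * n) ^ 4) * Real.log (7 * n * c₂ ^ 2 * M) ≤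
      M := by
  have hlog2 : 0.69 < Real.log 2 := lt_trans (by norm_num) Real.log_two_gt_d9
  have hcn : 1 ≤ c₃ * n := one_le_mul_of_one_le_of_one_le hc₃ hn
  have hcn₂ : 1 ≤ c₂ * n := one_le_mul_of_one_le_of_one_le hc₂ hn
  set u := Real.log (2 * c₃ * n) with hu
  set Q := c₂ * c₃ ^ 2 * n ^ 6 * u ^ 6 with hQ
  have hu2 : Real.log 2 ≤ u := Real.log_le_log (by norm_num) (by nlinarith)
  have hu0 : 0.69 ≤ u := by linarith
  have hupos : 0 < u := by linarith
  -- an eighth root of `c₂`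
  obtain ⟨t, ht1, ht8⟩ : ∃ t : ℝ, 1 ≤ t ∧ t ^ 8 = c₂ := by
    refine ⟨c₂ ^ (1 / 8 : ℝ), Real.one_le_rpow hc₂ (by norm_num), ?_⟩
    rw [← Real.rpow_natCast, ← Real.rpow_mul (by linarith)]
    norm_num
  have ht0 : 0 < t := by linarith
  have hlogc₂ : Real.log c₂ ≤ 8 * t := by
    rw [← ht8, Real.log_pow]
    push_cast
    linarith [Real.log_le_self ht0.le]
  have hn_u : Real.log n ≤ u := Real.log_le_log (by linarith) (by nlinarith)
  have h2n_u : Real.log (2 * n) ≤ u := Real.log_le_log (by linarith) (by nlinarith)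
  have hc_u : Real.log c₃ ≤ u := Real.log_le_log (by linarith) (by nlinarith)
  have htu : 0.69 ≤ t * u := by nlinarith
  have htle : t ≤ 1.45 * (t * u) := by nlinarith
  have hule : u ≤ t * u := by nlinarith
  have hℓ : Real.log (2 * c₂ * n) ≤ 13 * (t * u) := by
    have e : 2 * c₂ * n = c₂ * (2 * n) := by ring
    rw [e, Real.log_mul (by linarith) (by linarith)]
    linarith
  have hℓ0 : 0 ≤ Real.log (2 * c₂ * n) := Real.log_nonneg (by nlinarith)
  have hQ0 : 0 < Q := by positivity
  have hMpos : 0 < M := lt_of_lt_of_le (by positivity) hM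
  set R := √(M / Q) with hR
  have hR2 : R ^ 2 = M / Q := Real.sq_sqrt (by positivity)
  have hMR : M = Q * R ^ 2 := by rw [hR2]; field_simp
  have hRbig : 10 ^ 13 * 3 ≤ R := by
    refine Real.le_sqrt_of_sq_le ?_
    rw [le_div_iff₀ hQ0]
    linarith
  have hlog : Real.log (7 * n * c₂ ^ 2 * M) ≤ 53 * (t * u) + 2 * R := by
    have e : 7 * n * c₂ ^ 2 * M = 7 * (n ^ 7 * (c₂ ^ 3 * (c₃ ^ 2 * (u ^ 6 * R ^ 2)))) := by
      rw [hMR, hQ]; ring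
    have hR0 : 0 < R := by linarith
    rw [e, Real.log_mul (by norm_num) (by positivity), Real.log_mul (by positivity) (by positivity),
      Real.log_mul (by positivity) (by positivity), Real.log_mul (by positivity) (by positivity),
      Real.log_mul (by positivity) (by positivity), Real.log_pow, Real.log_pow, Real.log_pow,
      Real.log_pow, Real.log_pow]
    push_cast
    have h7 : Real.log 7 ≤ 3 * Real.log 2 := by
      rw [show 3 * Real.log 2 = Real.log (2 ^ 3) by rw [Real.log_pow]; norm_num]
      exact Real.log_le_log (by norm_num) (by norm_num)
    have hlogu := Real.log_le_self hupos.le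
    have hlogR := Real.log_le_self hR0.le
    linarith
  have hℓ4 : Real.log (2 * c₂ * n) ^ 4 ≤ (13 * (t * u)) ^ 4 := pow_le_pow_left₀ hℓ0 hℓ 4
  set P := c₃ ^ 2 * n ^ 6 with hP
  have hP0 : 0 < P := by positivity
  -- compare with `Q R² = t⁸ u⁶ P R²`
  have hfin : 53 * (t * u) + 2 * R ≤ 60 * ((t * u) ^ 2 * R) := by
    set v := t * u
    have : 0.69 ^ 2 ≤ v ^ 2 := pow_le_pow_left₀ (by norm_num) htu 2
    have h1 : v ^ 2 * R ≥ 0.476 * R := by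
      apply mul_le_mul_of_nonneg_right _ (by linarith)
      linarith
    have h2 : v ≤ v ^ 2 * R := by
      have : 1 ≤ v * R := by nlinarith
      nlinarith
    nlinarith
  have hR0 : 0 ≤ R := by linarith
  have hL0 : 0 ≤ P * Real.log (2 * c₂ * n) ^ 4 := mul_nonneg hP0.le (pow_nonneg hℓ0 4)
  have hV0 : 0 ≤ 60 * ((t * u) ^ 2 * R) :=
    mul_nonneg (by norm_num) (mul_nonneg (sq_nonneg _) hR0)
  have hS0 : 0 ≤ t ^ 6 * u ^ 6 * P * R :=
    mul_nonneg (mul_nonneg (by positivity) hP0.le) hR0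
  clear_value P R Q u
  calc 10690688 * (P * Real.log (2 * c₂ * n) ^ 4) * Real.log (7 * n * c₂ ^ 2 * M)
      ≤ 10690688 * (P * Real.log (2 * c₂ * n) ^ 4) * (60 * ((t * u) ^ 2 * R)) :=
        mul_le_mul_of_nonneg_left (hlog.trans hfin) (mul_nonneg (by norm_num) hL0)
    _ ≤ 10690688 * (P * (13 * (t * u)) ^ 4) * (60 * ((t * u) ^ 2 * R)) :=
        mul_le_mul_of_nonneg_right (mul_le_mul_of_nonneg_left
          (mul_le_mul_of_nonneg_left hℓ4 hP0.le) (by norm_num)) hV0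
    _ = (10690688 * 13 ^ 4 * 60) * ((t ^ 6 * u ^ 6 * P) * R) := by ring
    _ ≤ R * ((t ^ 8 * u ^ 6 * P) * R) := by
        have h6 : t ^ 6 ≤ t ^ 8 := pow_le_pow_right₀ ht1 (by norm_num)
        have hR : (10690688 * 13 ^ 4 * 60 : ℝ) ≤ R := le_trans (by norm_num) hRbig
        refine mul_le_mul hR (mul_le_mul_of_nonneg_right ?_ hR0) hS0 hR0
        exact mul_le_mul_of_nonneg_right (mul_le_mul_of_nonneg_right h6 (by positivity)) hP0.le
    _ = M := by rw [hMR, hQ, hP, ht8]; ring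

/-- The sum of the three error terms: the cubic Taylor error, the Gaussian tail and the Fourier
transform away from the lattice. -/
theorem error_le {n c₂ c₃ s : ℕ} {M m ε : ℝ} (hn : 1 ≤ n) (hc₂ : 1 ≤ c₂) (hc₃ : 1 ≤ c₃)
    (hs : (s : ℝ) ≤ 34 * (n * Real.log (2 * c₂ * n))) (hns : n ≤ s) (hMm : m ≤ 2 * M)
    (hM : 10 ^ 28 * (c₂ * c₃ ^ 2 * (n : ℝ) ^ 6 * Real.log (2 * c₃ * n) ^ 6) ≤ m)
    (hε : ε ^ 2 = 1 / (64 * c₃ ^ 2 * n)) :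
    2 * (600 * n ^ 2 / √M + Real.exp (-(M * ε ^ 2 / n ^ 2))) +
        Real.exp (-(8 * M * ε ^ 2 / s ^ 4)) *
          (2 * Real.pi * (n * (c₂ ^ 2 * M))) ^ ((n : ℝ) / 2) ≤
      10 ^ 28 * n ^ 3 * Real.log (2 * c₂ * n) ^ (3 / 2 : ℝ) / √m := by
  have hn1 : (1 : ℝ) ≤ n := by exact_mod_cast hn
  have hc₂1 : (1 : ℝ) ≤ c₂ := by exact_mod_cast hc₂
  have hc₃1 : (1 : ℝ) ≤ c₃ := by exact_mod_cast hc₃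
  have hns' : (n : ℝ) ≤ s := by exact_mod_cast hns
  have hlog2 : 0.69 < Real.log 2 := lt_trans (by norm_num) Real.log_two_gt_d9
  have hcn : (1 : ℝ) ≤ c₃ * n := one_le_mul_of_one_le_of_one_le hc₃1 hn1
  have hcn₂ : (1 : ℝ) ≤ c₂ * n := one_le_mul_of_one_le_of_one_le hc₂1 hn1
  set ℓ := Real.log (2 * c₂ * n) with hℓ
  set u := Real.log (2 * c₃ * n) with hu
  have hℓ0 : 0.69 ≤ ℓ := hlog2.le.trans (Real.log_le_log (by norm_num) (by nlinarith))
  have hu0 : 0.69 ≤ u := hlog2.le.trans (Real.log_le_log (by norm_num) (by nlinarith))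
  have hℓpos : 0 < ℓ := by linarith
  have hupos : 0 < u := by linarith
  have hspos : (0 : ℝ) < s := by linarith
  have hM1 : 1 ≤ M := by
    have h1 : 0.69 ^ 6 ≤ u ^ 6 := pow_le_pow_left₀ (by norm_num) hu0 6
    have h2 : 1 * 1 ^ 2 * 1 ^ 6 * 0.69 ^ 6 ≤ c₂ * c₃ ^ 2 * (n : ℝ) ^ 6 * u ^ 6 := by gcongr
    norm_num at h2
    linarith
  have hMpos : 0 < M := by linarith
  have hmpos : 0 < m := lt_of_lt_of_le (by positivity) hM
  have hkey := mul_log_le_of_le hn1 hc₂1 hc₃1 (M := M) (by rw [← hu]; linarith)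
  rw [← hℓ] at hkey
  set W := 7 * n * c₂ ^ 2 * M with hW
  have hWM : M ≤ W := by
    have : (1 : ℝ) ≤ 7 * n * c₂ ^ 2 := by nlinarith
    rw [hW]; nlinarith
  have hW1 : 1 ≤ W := hM1.trans hWM
  have hWpos : 0 < W := by linarith
  have hlogW : 0 ≤ Real.log W := Real.log_nonneg hW1
  have hY : ∀ x : ℝ, M / (10690688 * (c₃ ^ 2 * n ^ 5 * ℓ ^ 4)) ≤ x →
      Real.exp (-x) ≤ W ^ (-(n : ℝ)) := fun x hx => by
    rw [Real.rpow_def_of_pos hWpos, Real.exp_le_exp]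
    have h1 : n * Real.log W ≤ M / (10690688 * (c₃ ^ 2 * n ^ 5 * ℓ ^ 4)) := by
      rw [le_div_iff₀ (by positivity)]
      calc n * Real.log W * (10690688 * (c₃ ^ 2 * n ^ 5 * ℓ ^ 4))
          = 10690688 * (c₃ ^ 2 * n ^ 6 * ℓ ^ 4) * Real.log W := by ring
        _ ≤ M := hkey
    nlinarith
  have hWhalf : W ^ (-(1 / 2) : ℝ) ≤ 1 / √M := by
    rw [Real.rpow_neg hWpos.le, ← Real.sqrt_eq_rpow, ← one_div]
    gcongr
  have hE1 : Real.exp (-(M * ε ^ 2 / n ^ 2)) ≤ 1 / √M := by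
    refine (hY _ ?_).trans (le_trans ?_ hWhalf)
    · have e : M * ε ^ 2 / n ^ 2 = M / (64 * (c₃ ^ 2 * n ^ 3)) := by
        rw [hε]; field_simp
      rw [e]
      have h1 : 64 * ((c₃ : ℝ) ^ 2 * n ^ 3) ≤ 10690688 * (c₃ ^ 2 * n ^ 5 * ℓ ^ 4) := by
        have h2 : (1 : ℝ) ≤ n ^ 2 := one_le_pow₀ hn1
        have h3 : (0.69 : ℝ) ^ 4 ≤ ℓ ^ 4 := pow_le_pow_left₀ (by norm_num) hℓ0 4
        have h4 : 64 * ((c₃ : ℝ) ^ 2 * n ^ 3) ≤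
            10690688 * (1 * 0.69 ^ 4) * ((c₃ : ℝ) ^ 2 * n ^ 3) := by
          apply mul_le_mul_of_nonneg_right _ (by positivity)
          norm_num
        refine h4.trans ?_
        calc 10690688 * (1 * 0.69 ^ 4) * ((c₃ : ℝ) ^ 2 * n ^ 3)
            ≤ 10690688 * ((n : ℝ) ^ 2 * ℓ ^ 4) * ((c₃ : ℝ) ^ 2 * n ^ 3) := by gcongr
          _ = _ := by ring
      gcongr
    · exact Real.rpow_le_rpow_of_exponent_le hW1 (by linarith)
  have hE2 : Real.exp (-(8 * M * ε ^ 2 / s ^ 4)) *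
      (2 * Real.pi * (n * (c₂ ^ 2 * M))) ^ ((n : ℝ) / 2) ≤ 1 / √M := by
    have h1 : Real.exp (-(8 * M * ε ^ 2 / s ^ 4)) ≤ W ^ (-(n : ℝ)) := by
      refine hY _ ?_
      have e : 8 * M * ε ^ 2 / s ^ 4 = M / (8 * (c₃ ^ 2 * n) * s ^ 4) := by
        rw [hε]; field_simp; norm_num
      rw [e]
      have h2 : 8 * ((c₃ : ℝ) ^ 2 * n) * s ^ 4 ≤ 10690688 * (c₃ ^ 2 * n ^ 5 * ℓ ^ 4) := by
        calc 8 * ((c₃ : ℝ) ^ 2 * n) * s ^ 4 ≤ 8 * ((c₃ : ℝ) ^ 2 * n) * (34 * (n * ℓ)) ^ 4 := by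
              gcongr
          _ = 10690688 * (c₃ ^ 2 * n ^ 5 * ℓ ^ 4) := by ring
      gcongr
    have h2 : (2 * Real.pi * (n * (c₂ ^ 2 * M))) ^ ((n : ℝ) / 2) ≤ W ^ ((n : ℝ) / 2) := by
      apply Real.rpow_le_rpow (by positivity) _ (by positivity)
      have hpi : Real.pi < 3.15 := Real.pi_lt_d2
      have : 0 ≤ n * (c₂ ^ 2 * M) := by positivity
      rw [hW]
      nlinarith
    calc _ ≤ W ^ (-(n : ℝ)) * W ^ ((n : ℝ) / 2) := by gcongr
      _ = W ^ (-(n : ℝ) + (n : ℝ) / 2) := (Real.rpow_add hWpos _ _).symm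
      _ ≤ W ^ (-(1 / 2) : ℝ) := Real.rpow_le_rpow_of_exponent_le hW1 (by linarith)
      _ ≤ 1 / √M := hWhalf
  have hsqrt : √m ≤ 2 * √M := by
    rw [show (2 : ℝ) = √4 by rw [show (4 : ℝ) = 2 ^ 2 by norm_num, Real.sqrt_sq (by norm_num)],
      ← Real.sqrt_mul (by norm_num)]
    exact Real.sqrt_le_sqrt (by linarith)
  have hsM : 0 < √M := Real.sqrt_pos.2 hMpos
  have hsm : 0 < √m := Real.sqrt_pos.2 hmpos
  have hinv : 1 / √M ≤ 2 / √m := by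
    rw [div_le_div_iff₀ hsM hsm]; linarith
  have hℓ32 : (0.4 : ℝ) ≤ ℓ ^ (3 / 2 : ℝ) := by
    calc (0.4 : ℝ) ≤ 0.69 ^ (2 : ℝ) := by norm_num
      _ ≤ 0.69 ^ (3 / 2 : ℝ) :=
        Real.rpow_le_rpow_of_exponent_ge (by norm_num) (by norm_num) (by norm_num)
      _ ≤ ℓ ^ (3 / 2 : ℝ) := Real.rpow_le_rpow (by norm_num) hℓ0 (by norm_num)
  have hn23 : (n : ℝ) ^ 2 ≤ n ^ 3 := pow_le_pow_right₀ hn1 (by norm_num)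
  have hn3 : (1 : ℝ) ≤ n ^ 3 := one_le_pow₀ hn1
  calc _ ≤ 2 * (600 * n ^ 2 * (1 / √M) + 1 / √M) + 1 / √M := by
        have : 600 * (n : ℝ) ^ 2 / √M = 600 * n ^ 2 * (1 / √M) := by ring
        rw [this]
        linarith
    _ = (1200 * n ^ 2 + 3) * (1 / √M) := by ring
    _ ≤ (1203 * n ^ 3) * (2 / √m) := by
        gcongr
        linarith
    _ ≤ (10 ^ 28 * n ^ 3 * 0.4) / √m := by
        rw [mul_div_assoc']
        refine div_le_div_of_nonneg_right ?_ hsm.le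
        linarith
    _ ≤ _ := by gcongr

end Numerics

/-! ### The local limit theorem -/

section LocalLimit

open MeasureTheory
open scoped RealInnerProductSpace

variable {B : Type*} [Fintype B] {V : Submodule ℚ (B → ℚ)} {n : ℕ} {φ : Basis (Fin n) ℚ V}
  {Φ : B → Fin n → ℤ}

omit [Fintype B] in
theorem sum_intCast_mul_eq_mulVec (hφ : ∀ a b, (φ a : B → ℚ) b = Φ b a) (θ : Fin n → ℝ) :
    (fun b => ∑ a, (Φ b a : ℝ) * θ a) = basisMatrix φ *ᵥ θ := by
  ext b
  simp [Matrix.mulVec, dotProduct, basisMatrix_eq_intCast hφ]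

theorem eq_zero_of_mulVec_eq_zero (φ : Basis (Fin n) ℚ V) {θ : Fin n → ℝ}
    (h : basisMatrix φ *ᵥ θ = 0) : θ = 0 := by
  have h1 : ((basisMatrix φ)ᵀ * basisMatrix φ) *ᵥ θ = 0 := by
    rw [← Matrix.mulVec_mulVec, h, Matrix.mulVec_zero]
  rw [← Matrix.one_mulVec θ, ← Matrix.nonsing_inv_mul _ (isUnit_det_gram φ),
    ← Matrix.mulVec_mulVec, h1, Matrix.mulVec_zero]

/-- Coordinates of a function none of whose lattice translates is uniformly small: some value of
the function is far from the integers. -/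
theorem exists_le_abs_sub_round {c : ℕ}
    (h : HasBoundedIntegerBasis l1Norm c (orthogonalComplement V))
    (hφ : ∀ a b, (φ a : B → ℚ) b = Φ b a) (hΦ : Submodule.span ℤ (Set.range Φ) = ⊤) {ε : ℝ}
    (hε : c * ε < 1) {θ : Fin n → ℝ}
    (hθ : ∀ k : Fin n → ℤ, ¬ ∀ b, |(basisMatrix φ *ᵥ (θ + fun a => (k a : ℝ))) b| < ε) :
    ∃ b, ε ≤ |(basisMatrix φ *ᵥ θ) b - round ((basisMatrix φ *ᵥ θ) b)| := by
  by_contra! hlt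
  set f := basisMatrix φ *ᵥ θ with hf
  have hperp : ∀ g ∈ orthogonalComplement V, ∑ b, f b * g b = 0 := by
    intro g hg
    have h1 : ∀ f' ∈ V, ∑ b, g b * f' (id b) = 0 := fun f' hf' => by
      rw [← hg f' hf']
      exact Finset.sum_congr rfl fun b _ => mul_comm _ _
    have h2 := sum_mul_eq_zero_of_mem_realSpan h1 (mulVec_mem_realSpan φ θ)
    rw [← h2]
    exact Finset.sum_congr rfl fun b _ => mul_comm _ _
  have hround := round_mem h hperp hε fun b => (hlt b).le
  obtain ⟨k, hk⟩ := exists_mulVec_eq φ (f := fun b => (((round (f b) : ℚ)) : ℝ))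
    (Submodule.subset_span ⟨_, hround, rfl⟩)
  have hkint : ∀ a, ∃ l : ℤ, k a = l := fun a =>
    exists_intCast_of_span_eq_top hΦ (fun b => ⟨round (f b), by
      have h1 := congrFun (sum_intCast_mul_eq_mulVec hφ k) b
      rw [h1, ← hk]
      simp⟩) a
  choose l hl using hkint
  refine hθ (-l) fun b => ?_
  have e : (fun a => (((-l) a : ℤ) : ℝ)) = -k := by
    ext a
    simp [hl]
  rw [e, Matrix.mulVec_add, Matrix.mulVec_neg, ← hk]
  simpa [sub_eq_add_neg] using hlt b

/-- The inversion formula, with the integral over the cube replaced by an integral over a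
neighbourhood of the origin in orthonormal coordinates. -/
theorem norm_setBernoulli_real_sub_le {c₂ c₃ s : ℕ}
    (h₂ : HasBoundedIntegerBasis lInftyNorm c₂ V)
    (h₃ : HasBoundedIntegerBasis l1Norm c₃ (orthogonalComplement V))
    (hsym : ∀ b₁ b₂ : B, ∃ π : Equiv.Perm B, IsSymmetry V π ∧ π b₁ = b₂)
    (hφ : ∀ a b, (φ a : B → ℚ) b = Φ b a) (hΦ : Submodule.span ℤ (Set.range Φ) = ⊤)
    (hs : (2 * (s * c₂) + 1) ^ n < 2 ^ s) {ε : ℝ} (hε₀ : 0 < ε) (hε₁ : ε ≤ 1 / 8)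
    (hε : c₃ * ε < 1) {T : Matrix (Fin n) (Fin n) ℝ} (hT : T.det ≠ 0) {p : ℝ} (hp₀ : 0 ≤ p)
    (hp₁ : p ≤ 1) (γ : B → ℤ) :
    ‖(((setBernoulli (Set.univ : Set B) ⟨p, hp₀, hp₁⟩).real
        {T : Set B | ∀ f ∈ V, ∑ b, T.indicator f b = ∑ b, (γ b : ℚ) * f b} : ℝ) : ℂ) -
      |T.det| • ∫ y in {y : EuclideanSpace ℝ (Fin n) | ∀ b, |⟪frameVector φ T b, y⟫| < ε},
        fourierIntegrand p γ fun b => ⟪frameVector φ T b, y⟫‖ ≤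
      Real.exp (-(8 * (p * (1 - p) * Fintype.card B) * ε ^ 2 / s ^ 4)) := by
  classical
  set M := basisMatrix φ with hM
  have hE : ∀ S : Finset B,
      (S : Set B) ∈ {T : Set B | ∀ f ∈ V, ∑ b, T.indicator f b = ∑ b, (γ b : ℚ) * f b} ↔
      ∀ a, ∑ b ∈ S, Φ b a = ∑ b, γ b * Φ b a := by
    intro S
    have hind : ∀ f : B → ℚ, ∑ b, (S : Set B).indicator f b = ∑ b ∈ S, f b := fun f => by
      rw [Finset.sum_indicator_subset f (Finset.subset_univ S)]
    simp only [Set.mem_ofPred_eq, hind]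
    constructor
    · intro h a
      have := h (φ a) (φ a).2
      simp only [hφ] at this
      exact_mod_cast this
    · intro h f hf
      have h1 : ∀ a, ∑ b ∈ S, (φ a : B → ℚ) b = ∑ b, (γ b : ℚ) * (φ a : B → ℚ) b := fun a => by
        simp only [hφ]
        exact_mod_cast h a
      have hfr : f = ∑ a, φ.repr ⟨f, hf⟩ a • (φ a : B → ℚ) := by
        have := congrArg (fun v : V => (v : B → ℚ)) (φ.sum_repr ⟨f, hf⟩)
        simpa [-Basis.sum_repr] using this.symm
      rw [hfr]
      simp only [Finset.sum_apply, Pi.smul_apply, smul_eq_mul, Finset.mul_sum]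
      rw [Finset.sum_comm, Finset.sum_comm (s := (Finset.univ : Finset B))]
      refine Finset.sum_congr rfl fun a _ => ?_
      rw [← Finset.mul_sum, h1 a, Finset.mul_sum]
      exact Finset.sum_congr rfl fun b _ => by ring
  rw [setBernoulli_real_eq_integral p hp₀ hp₁ γ Φ hE]
  simp only [sum_intCast_mul_eq_mulVec hφ]
  set H : (Fin n → ℝ) → ℂ := fun θ => fourierIntegrand p γ (M *ᵥ θ) with hH
  have hHc : Continuous H := by
    have h1 := continuous_fourierIntegrand p γ
    have h2 : Continuous fun θ : Fin n → ℝ => M *ᵥ θ := by fun_prop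
    exact h1.comp h2
  set Z : Set (Fin n → ℝ) := {θ | ∀ b, |(M *ᵥ θ) b| < ε} with hZ
  have hZm : MeasurableSet Z := by
    have : Z = ⋂ b, {θ | |(M *ᵥ θ) b| < ε} := by ext; simp [hZ]
    rw [this]
    refine MeasurableSet.iInter fun b => (isOpen_lt ?_ continuous_const).measurableSet
    have h2 : Continuous fun θ : Fin n → ℝ => M *ᵥ θ := by fun_prop
    exact ((continuous_apply b).comp h2).abs
  have hcoord : (|T.det| • ∫ y in {y : EuclideanSpace ℝ (Fin n) |
      ∀ b, |⟪frameVector φ T b, y⟫| < ε},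
        fourierIntegrand p γ fun b => ⟪frameVector φ T b, y⟫) = ∫ θ in Z, H θ := by
    rw [setIntegral_mulVec T hT Z hZm H hHc]
    simp only [inner_frameVector]
    rfl
  rw [hcoord]
  have hFd := ZSpan.isAddFundamentalDomain (Pi.basisFun ℝ (Fin n)) volume
  rw [ZSpan.fundamentalDomain_pi_basisFun] at hFd
  set Λ := Submodule.span ℤ (Set.range (Pi.basisFun ℝ (Fin n))) with hΛ
  have hmem : ∀ g : Λ, ∃ k : Fin n → ℤ, (g : Fin n → ℝ) = fun a => (k a : ℝ) := by
    intro g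
    have h1 := ((Pi.basisFun ℝ (Fin n)).mem_span_iff_repr_mem ℤ _).1 g.2
    choose k hk using h1
    refine ⟨k, funext fun a => ?_⟩
    simpa using (hk a).symm
  have hmem' : ∀ k : Fin n → ℤ, (fun a => (k a : ℝ)) ∈ Λ := fun k => by
    rw [hΛ, Basis.mem_span_iff_repr_mem]
    exact fun a => ⟨k a, by simp⟩
  have hMint : ∀ (k : Fin n → ℤ) b, (M *ᵥ fun a => (k a : ℝ)) b = ((∑ a, Φ b a * k a : ℤ) : ℝ) :=
    fun k b => by
      rw [← sum_intCast_mul_eq_mulVec hφ]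
      push_cast
      rfl
  have : VAddInvariantMeasure Λ (Fin n → ℝ) volume :=
    ⟨fun g t _ => measure_preimage_add volume (g : Fin n → ℝ) t⟩
  refine norm_setIntegral_sub_setIntegral_le (G := Λ) hFd
    (MeasurableSet.univ_pi fun _ => measurableSet_Ico) ?_ hZm ?_ ?_ ?_ (Real.exp_nonneg _) ?_
  · rw [volume_pi, Measure.pi_pi]
    simp
  · intro g θ hθ hgθ
    obtain ⟨k, hk⟩ := hmem g
    have h0 : M *ᵥ (g : Fin n → ℝ) = 0 := by
      ext b
      have h1 : |(M *ᵥ θ) b| < ε := hθ b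
      have h2 : |(M *ᵥ ((g : Fin n → ℝ) + θ)) b| < ε := hgθ b
      rw [Matrix.mulVec_add, Pi.add_apply] at h2
      rw [hk, hMint] at h2 ⊢
      have h3 : |((∑ a, Φ b a * k a : ℤ) : ℝ)| < 1 := by
        rw [abs_lt] at *
        constructor <;> linarith [h1.1, h1.2, h2.1, h2.2]
      have h4 : |∑ a, Φ b a * k a| < 1 := by exact_mod_cast h3
      rw [Int.abs_lt_one_iff.1 h4]
      simp
    exact Subtype.ext (eq_zero_of_mulVec_eq_zero φ h0)
  · intro g θ
    obtain ⟨k, hk⟩ := hmem g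
    have e : M *ᵥ (g +ᵥ θ) = fun b => (M *ᵥ θ) b + ((∑ a, Φ b a * k a : ℤ) : ℝ) := by
      have : g +ᵥ θ = θ + (g : Fin n → ℝ) := add_comm _ _
      ext b
      rw [this, Matrix.mulVec_add, Pi.add_apply, hk, hMint]
    change fourierIntegrand p γ (M *ᵥ (g +ᵥ θ)) = fourierIntegrand p γ (M *ᵥ θ)
    rw [e, fourierIntegrand_add_intCast]
  · exact IntegrableOn.mono_set
      (hHc.continuousOn.integrableOn_compact (isCompact_univ_pi fun _ => isCompact_Icc))
      (Set.pi_mono fun _ _ => Set.Ico_subset_Icc_self)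
  · intro θ hθ
    obtain ⟨b₀, hb₀⟩ := exists_le_abs_sub_round h₃ hφ hΦ hε (θ := θ) fun k hk =>
      hθ ⟨_, hmem' k⟩ fun b => by
        have : (⟨_, hmem' k⟩ : Λ) +ᵥ θ = θ + fun a => (k a : ℝ) := add_comm _ _
        rw [this]
        exact hk b
    rw [norm_fourierIntegrand]
    exact norm_prod_bernoulliChar_le h₂ φ hs hsym (mulVec_mem_realSpan φ θ) hp₀ hp₁ hε₀.le hb₀

/-- The local limit theorem for a space of positive dimension, with the three error terms. -/
theorem exists_error_of_pos {c₂ c₃ s : ℕ} (hn : 1 ≤ n)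
    (h₂ : HasBoundedIntegerBasis lInftyNorm c₂ V)
    (h₃ : HasBoundedIntegerBasis l1Norm c₃ (orthogonalComplement V))
    (hsym : ∀ b₁ b₂ : B, ∃ π : Equiv.Perm B, IsSymmetry V π ∧ π b₁ = b₂)
    (hφ : ∀ a b, (φ a : B → ℚ) b = Φ b a) (hΦ : Submodule.span ℤ (Set.range Φ) = ⊤)
    (hB : 0 < (Fintype.card B : ℝ))
    (hs : (2 * (s * c₂) + 1) ^ n < 2 ^ s) {ε : ℝ} (hε₀ : 0 < ε) (hε₁ : ε ≤ 1 / 8)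
    (hε : c₃ * ε < 1) (hε₂ : 64 * n * ε ^ 2 ≤ 1) {p : ℝ} (hp₀ : 0 < p) (hp₁ : p < 1)
    (γ : B → ℤ) :
    ∃ δ : ℝ, |δ| ≤ 2 * (600 * n ^ 2 / √(p * (1 - p) * Fintype.card B) +
          Real.exp (-(p * (1 - p) * Fintype.card B * ε ^ 2 / n ^ 2))) +
        Real.exp (-(8 * (p * (1 - p) * Fintype.card B) * ε ^ 2 / s ^ 4)) *
          (2 * Real.pi * (n * (c₂ ^ 2 * (p * (1 - p) * Fintype.card B)))) ^ ((n : ℝ) / 2) ∧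
      (setBernoulli (Set.univ : Set B) ⟨p, hp₀.le, hp₁.le⟩).real
          {T : Set B | ∀ f ∈ V, ∑ b, T.indicator f b = ∑ b, (γ b : ℚ) * f b} =
        rho V / (2 * Real.pi * p * (1 - p)) ^ ((n : ℝ) / 2) *
          (Real.exp (-(normV V (fun b => (γ b : ℝ) - p) ^ 2 / (2 * p * (1 - p)))) + δ) := by
  obtain ⟨T, hT1, hT2, hT3⟩ := exists_orthonormalizing φ
  have hrho : rho V = |T.det| := by rw [rho_eq_inv_sqrt_det hφ hΦ, hT3]
  set q := p * (1 - p) with hq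
  have hqpos : 0 < q := mul_pos hp₀ (by linarith)
  set N : ℝ := (Fintype.card B : ℝ) with hN
  set g := ((basisMatrix φ)ᵀ * basisMatrix φ).det with hg
  have hg0 : g ≠ 0 := (isUnit_det_gram φ).ne_zero
  have hgpos : 0 < g := by
    have h1 := (Matrix.posSemidef_conjTranspose_mul_self (basisMatrix φ)).det_nonneg
    have h2 : 0 ≤ g := by simpa [hg] using h1
    exact lt_of_le_of_ne h2 hg0.symm
  have hρpos : 0 < |T.det| := by rw [hT3]; positivity
  have hTdet : T.det ≠ 0 := abs_pos.1 hρpos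
  have hpi := Real.pi_pos
  set A : ℝ := (2 * Real.pi * q) ^ ((n : ℝ) / 2) with hA
  have hApos : 0 < A := by positivity
  have hAeq : (2 * Real.pi * p * (1 - p)) ^ ((n : ℝ) / 2) = A := by
    rw [hA, hq, mul_assoc (2 * Real.pi)]
  have hfar := norm_setBernoulli_real_sub_le h₂ h₃ hsym hφ hΦ hs hε₀ hε₁ hε hTdet hp₀.le hp₁.le γ
  have hnear := norm_setIntegral_sub_gaussian_le hn (finrank_euclideanSpace_fin (𝕜 := ℝ) (n := n))
    hp₀ hp₁ hB (sum_inner_frameVector_sq φ hT1)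
    (fun b => (norm_frameVector_sq φ hT1 (isUnit_iff_ne_zero.2 hTdet) hsym b).le)
    hε₀ hε₁ hε₂ (fun b => (γ b : ℝ))
  rw [norm_sum_smul_frameVector_sq φ hT2 (fun b => (γ b : ℝ) - p), ← hq, ← hA] at hnear
  rw [hrho, hAeq]
  have hq2 : 2 * p * (1 - p) = 2 * q := by rw [hq]; ring
  rw [hq2]
  set G := Real.exp (-(normV V (fun b => (γ b : ℝ) - p) ^ 2 / (2 * q)))
  set P := (setBernoulli (Set.univ : Set B) ⟨p, hp₀.le, hp₁.le⟩).real
          {T : Set B | ∀ f ∈ V, ∑ b, T.indicator f b = ∑ b, (γ b : ℚ) * f b}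
  set X := 600 * (n : ℝ) ^ 2 / √(q * N) + Real.exp (-(q * N * ε ^ 2 / n ^ 2))
  set r := Real.exp (-(8 * (q * N) * ε ^ 2 / s ^ 4))
  set I := ∫ y in {y : EuclideanSpace ℝ (Fin n) | ∀ b, |⟪frameVector φ T b, y⟫| < ε},
        fourierIntegrand p γ fun b => ⟪frameVector φ T b, y⟫
  have hnear' : ‖I - ((G / A : ℝ) : ℂ)‖ ≤ X * (2 / A) := hnear
  have hmain : |P - |T.det| * (G / A)| ≤ r + |T.det| * (X * (2 / A)) := by
    rw [← Real.norm_eq_abs, ← Complex.norm_real]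
    have e : ((P - |T.det| * (G / A) : ℝ) : ℂ) =
        ((P : ℂ) - |T.det| • I) + |T.det| • (I - ((G / A : ℝ) : ℂ)) := by
      rw [smul_sub, Complex.real_smul, Complex.real_smul]
      push_cast
      ring
    rw [e]
    refine (norm_add_le _ _).trans (add_le_add hfar ?_)
    rw [norm_smul, Real.norm_of_nonneg hρpos.le]
    gcongr
  have hinvρ : A / |T.det| ≤ (2 * Real.pi * (n * (c₂ ^ 2 * (q * N)))) ^ ((n : ℝ) / 2) := by
    have h1 : A / |T.det| = A * √g := by rw [hT3, div_div_eq_mul_div, div_one]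
    have h2 : √g ≤ (n * (c₂ ^ 2 * N)) ^ ((n : ℝ) / 2) := by
      have h3 : g ≤ (n * (c₂ ^ 2 * N)) ^ n := det_gram_le h₂ hφ hΦ
      refine (Real.sqrt_le_sqrt h3).trans (le_of_eq ?_)
      rw [Real.sqrt_eq_rpow, ← Real.rpow_natCast, ← Real.rpow_mul (by positivity)]
      congr 1
      ring
    rw [h1]
    calc A * √g ≤ A * (n * (c₂ ^ 2 * N)) ^ ((n : ℝ) / 2) := by gcongr
      _ = _ := by
        rw [hA, ← Real.mul_rpow (by positivity) (by positivity)]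
        congr 1
        ring
  refine ⟨(P - |T.det| * (G / A)) * (A / |T.det|), ?_, ?_⟩
  · rw [abs_mul, abs_of_pos (show 0 < A / |T.det| by positivity)]
    calc |P - |T.det| * (G / A)| * (A / |T.det|)
        ≤ (r + |T.det| * (X * (2 / A))) * (A / |T.det|) := by gcongr
      _ = 2 * X + r * (A / |T.det|) := by field_simp; ring
      _ ≤ _ := by gcongr
  · field_simp
    ring

end LocalLimit

end RandomSubset

end

theorem theorem4p11 :
    ∃ C : ℝ, 0 < C ∧
      ∀ (B : Type*) [Fintype B] (V : Submodule ℚ (B → ℚ)) (c₂ c₃ : ℕ), 1 ≤ c₂ → 1 ≤ c₃ →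
        RandomSubset.HasBoundedIntegerBasis RandomSubset.lInftyNorm c₂ V →
        RandomSubset.HasBoundedIntegerBasis RandomSubset.l1Norm c₃
          (RandomSubset.orthogonalComplement V) →
        (∀ b₁ b₂ : B, ∃ π : Equiv.Perm B, RandomSubset.IsSymmetry V π ∧ π b₁ = b₂) →
        ∀ (p : ℝ) (hp₀ : 0 < p) (hp₁ : p < 1),
          C * (c₂ * c₃ ^ 2 * (Module.finrank ℚ V : ℝ) ^ 6 *
              Real.log (2 * c₃ * Module.finrank ℚ V) ^ 6) ≤
            min (p * Fintype.card B) ((1 - p) * Fintype.card B) →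
          ∀ γ : B → ℤ, ∃ δ : ℝ,
            |δ| ≤ C * (Module.finrank ℚ V : ℝ) ^ 3 *
                Real.log (2 * c₂ * Module.finrank ℚ V) ^ (3 / 2 : ℝ) /
              √(min (p * Fintype.card B) ((1 - p) * Fintype.card B)) ∧
            (ProbabilityTheory.setBernoulli (Set.univ : Set B) ⟨p, hp₀.le, hp₁.le⟩).real
                {T : Set B | ∀ f ∈ V, ∑ b, T.indicator f b = ∑ b, (γ b : ℚ) * f b} =
              RandomSubset.rho V /
                  (2 * Real.pi * p * (1 - p)) ^ ((Module.finrank ℚ V : ℝ) / 2) *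
                (Real.exp (-(RandomSubset.normV V (fun b => (γ b : ℝ) - p) ^ 2 /
                    (2 * p * (1 - p)))) + δ) := by
  refine ⟨10 ^ 28, by norm_num, ?_⟩
  intro B _ V c₂ c₃ hc₂ hc₃ h₂ h₃ hsym p hp₀ hp₁ hsize γ
  obtain ⟨n, φ, Φ, hφ, hΦ⟩ := RandomSubset.exists_integer_basis V
  have hfin : finrank ℚ V = n := by rw [finrank_eq_card_basis φ, Fintype.card_fin]
  rw [hfin] at hsize ⊢
  rcases Nat.eq_zero_or_pos n with hn | hn
  · -- the event is certain, and both sides of the formula are `1`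
    subst hn
    have hV : ∀ f ∈ V, f = 0 := fun f hf => by
      have := φ.sum_repr ⟨f, hf⟩
      simpa using (congrArg Subtype.val this).symm
    have hEv : {T : Set B | ∀ f ∈ V, ∑ b, T.indicator f b = ∑ b, (γ b : ℚ) * f b} =
        Set.univ := by
      ext T
      simp only [Set.mem_ofPred_eq, Set.mem_univ, iff_true]
      intro f hf
      simp [hV f hf]
    have hproj : RandomSubset.normV V (fun b => (γ b : ℝ) - p) = 0 := by
      rw [RandomSubset.normV, RandomSubset.formV_eq φ]
      have : RandomSubset.basisMatrix φ *
          ((RandomSubset.basisMatrix φ)ᵀ * RandomSubset.basisMatrix φ)⁻¹ *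
          (RandomSubset.basisMatrix φ)ᵀ = 0 := by
        ext i j
        simp [Matrix.mul_apply]
      rw [this]
      simp
    refine ⟨0, by simp, ?_⟩
    rw [hEv, hproj, RandomSubset.rho_eq_inv_sqrt_det hφ hΦ]
    simp
  · have hn1 : (1 : ℝ) ≤ n := by exact_mod_cast hn
    have hc₃1 : (1 : ℝ) ≤ c₃ := by exact_mod_cast hc₃
    set N : ℝ := (Fintype.card B : ℝ) with hN
    set m := min (p * N) ((1 - p) * N) with hm
    have hN0 : 0 ≤ N := Nat.cast_nonneg _
    have hmpos : 0 < m := by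
      refine lt_of_lt_of_le ?_ hsize
      have : 0 < Real.log (2 * c₃ * n) := by
        apply Real.log_pos
        have : (1 : ℝ) ≤ c₃ * n := one_le_mul_of_one_le_of_one_le hc₃1 hn1
        linarith
      positivity
    have hNpos : 0 < N := by
      rcases hN0.eq_or_lt with h | h
      · rw [hm, ← h] at hmpos
        simp at hmpos
      · exact h
    have hm2 : m ≤ 2 * (p * (1 - p) * N) := by
      rcases le_total p (1 / 2) with h | h
      · refine (min_le_left _ _).trans ?_
        nlinarith [mul_pos hp₀ hNpos]
      · refine (min_le_right _ _).trans ?_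
        nlinarith [mul_pos (sub_pos.2 hp₁) hNpos]
    obtain ⟨s, hs1, hs2, hs3⟩ := RandomSubset.exists_tuple_length hn hc₂
    set ε : ℝ := 1 / (8 * c₃ * √n) with hε
    have hsn : 1 ≤ √(n : ℝ) := Real.one_le_sqrt.2 hn1
    have hεpos : 0 < ε := by positivity
    have hεsq : ε ^ 2 = 1 / (64 * c₃ ^ 2 * n) := by
      rw [hε, div_pow, mul_pow, mul_pow, Real.sq_sqrt (by linarith)]
      norm_num
    have hc₃ε : c₃ * ε ≤ 1 / 8 := by
      have : c₃ * ε = 1 / (8 * √n) := by rw [hε]; field_simp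
      rw [this]
      apply one_div_le_one_div_of_le <;> linarith
    have hε8 : ε ≤ 1 / 8 := by nlinarith
    have hε64 : 64 * n * ε ^ 2 ≤ 1 := by
      rw [hεsq, mul_one_div, div_le_one (by positivity)]
      have : (1 : ℝ) ≤ c₃ ^ 2 := one_le_pow₀ hc₃1
      nlinarith
    obtain ⟨δ, hδ, hP⟩ := RandomSubset.exists_error_of_pos hn h₂ h₃ hsym hφ hΦ hNpos hs1 hεpos
      hε8 (by linarith) hε64 hp₀ hp₁ γ
    exact ⟨δ, hδ.trans (RandomSubset.error_le hn hc₂ hc₃ hs2 hs3 hm2 hsize hεsq), hP⟩
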